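/- Consider base stations (BSs) of two tiers $k\in\{s,m\}$ (SBS and MBS) located on $\mathbb R^2$ as independent homogeneous Poisson point processes of densities $\lambda_s,\lambda_m>0$, and a typical user at the origin. Tier $k$ has transmission power $P_k^{tr}>0$ and association bias $B_k>0$. Given the locations, the link between the user and a BS at distance $r$ is, independently for each BS, line of sight ($\mathrm L$) with probability $\mathcal P_{\mathrm L}(r)=\min(18/r,1)(1-e^{-\beta r})+e^{-\beta r}$ ($\beta\ge0$), and non line of sight ($\mathrm{NL}$) with probability $\mathcal P_{\mathrm{NL}}(r)=1-\mathcal P_{\mathrm L}(r)$; a link of condition $\nu\in\{\mathrm L,\mathrm{NL}\}$ has path loss $A_\nu r^{-\alpha_\nu}$ ($A_\nu,\alpha_\nu>0$). The fading powers $h$ are i.i.d. exponential of mean $1$ (Rayleigh fading), independent of the rest. The user is served by the BS with the largest biased received power $P_k^{tr}B_kA_\nu r^{-\alpha_\nu}$, and $$\mathrm{SINR}=\frac{P_k^{tr}B_k\,h\,A_\nu r^{-\alpha_\nu}}{I+N_0},$$ where $k$, $\nu$, $r$, $h$ are the tier, link condition, distance and fading of the serving BS, $N_0\ge0$ is the noise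 power and $I$ is the sum of $P_j^{tr}B_jh'A_\mu (r')^{-\alpha_\mu}$ over all the other BSs of both tiers (tier $j$, link condition $\mu$, distance $r'$, fading $h'$). Let $F_k^\nu(r)$ be the density of the serving distance $r$ on the event that the user is served by tier $k$ over a link of condition $\nu$ (the association density); explicitly, for $r>0$, $$F_k^\nu(r)=f_k^\nu(r)\prod_{(j,\mu)\ne(k,\nu)}p_{j\mu}\big(\rho_{j\mu}(r)\big),\qquad f_k^\nu(r)=2\pi\lambda_k r\,\mathcal P_\nu(r)\,p_{k\nu}(r),$$ with $p_{j\mu}(R)=\exp\big(-\int_0^{R}2\pi\lambda_j u\,\mathcal P_\mu(u)\,du\big)$ and $\rho_{j\mu}(r)=\Big(\frac{P_j^{tr}B_jA_\mu}{P_k^{tr}B_kA_\nu}\Big)^{1/\alpha_\mu}r^{\alpha_\nu/\alpha_\mu}$. Let $\mathcal L_{I_k}^\nu(r;t)$ be the conditional Laplace transform of the normalized interference, $\mathbb E\big[\exp\big(-t\,I/(P_k^{tr}B_kA_\nu)\big)\big]$ given that the user is served by tier $k$ over a link of condition $\nu$ and length $r$; it is the same expectation with $I$ replaced by the sum over those BSs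 of the original network whose biased received power is at most $P_k^{tr}B_kA_\nu r^{-\alpha_\nu}$. Then for every $k\in\{s,m\}$ and every $\gamma>0$, the probability $\mathbb P_k^{cov}(\gamma)$ that the user is served by tier $k$ and $\mathrm{SINR}>\gamma$, and the probabilities $P_{k,\nu}^{cov}(\gamma)$ that it is served by tier $k$ over a link of condition $\nu$ and $\mathrm{SINR}\ge\gamma$, satisfy $$\mathbb P_k^{cov}(\gamma)=P_{k,\mathrm L}^{cov}(\gamma)+P_{k,\mathrm{NL}}^{cov}(\gamma),$$ $$P_{k,\nu}^{cov}(\gamma)=\int_0^\infty\exp\Big(\frac{-\gamma N_0r^{\alpha_\nu}}{P_k^{tr}B_kA_\nu}\Big)\,\mathcal L_{I_k}^{\nu}\big(r;\gamma r^{\alpha_\nu}\big)\,F_k^\nu(r)\,dr,\qquad \nu\in\{\mathrm L,\mathrm{NL}\}.$$ -/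

import Mathlib

open MeasureTheory ProbabilityTheory Set
open scoped ENNReal

noncomputable section

namespace MmWave

/-- The two tiers of base stations: small cells and macro cells. -/
inductive Tier where
  | sbs
  | mbs
deriving DecidableEq

/-- The two propagation conditions of a link: line of sight and non line of sight. -/
inductive Link where
  | los
  | nlos
deriving DecidableEq

instance : Fintype Tier where
  elems := {Tier.sbs, Tier.mbs}
  complete := by intro x; cases x <;> simp

instance : Fintype Link where
  elems := {Link.los, Link.nlos}
  complete := by intro x; cases x <;> simp

/-- The plane in which base stations are located. -/
abbrev Plane : Type := EuclideanSpace ℝ (Fin 2)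

/-- The deterministic parameters of the network. -/
structure Params where
  /-- base station densities -/
  lam : Tier → ℝ
  /-- transmission powers -/
  Ptr : Tier → ℝ
  /-- association bias factors -/
  B : Tier → ℝ
  /-- path loss constants -/
  A : Link → ℝ
  /-- path loss exponents -/
  α : Link → ℝ
  /-- blockage parameter -/
  β : ℝ
  /-- noise power -/
  N₀ : ℝ
  lam_pos : ∀ k, 0 < lam k
  Ptr_pos : ∀ k, 0 < Ptr k
  B_pos : ∀ k, 0 < B k
  A_pos : ∀ ν, 0 < A ν
  α_pos : ∀ ν, 0 < α ν
  β_nonneg : 0 ≤ β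
  N₀_nonneg : 0 ≤ N₀

namespace Params

variable (p : Params)

/-- The probability that a link of length `r` is line of sight. -/
def losProb (r : ℝ) : ℝ :=
  min (18 / r) 1 * (1 - Real.exp (-p.β * r)) + Real.exp (-p.β * r)

/-- The probability that a link of length `r` is in a given condition. -/
def linkProb (ν : Link) (r : ℝ) : ℝ :=
  match ν with
  | Link.los => p.losProb r
  | Link.nlos => 1 - p.losProb r

/-- The path loss `A r ^ (-α)` of a link of length `r`. -/
def pathLoss (ν : Link) (r : ℝ) : ℝ := p.A ν * r ^ (-p.α ν)

/-- The biased received power (before fading) from a base station of tier `k` over a link of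
condition `ν` and length `r`. -/
def biasedPower (k : Tier) (ν : Link) (r : ℝ) : ℝ := p.Ptr k * p.B k * p.pathLoss ν r

/-- The distance at which a base station of tier `j` with link condition `μ` offers the same biased
received power as one of tier `k` with link condition `ν` at distance `r`. -/
def exclusionRadius (k : Tier) (ν : Link) (j : Tier) (μ : Link) (r : ℝ) : ℝ :=
  (p.Ptr j * p.B j * p.A μ / (p.Ptr k * p.B k * p.A ν)) ^ (1 / p.α μ) * r ^ (p.α ν / p.α μ)

/-- The probability that the disc of radius `R` around the user contains no base station of tier
`k` with link condition `ν`. -/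
def voidProb (k : Tier) (ν : Link) (R : ℝ) : ℝ :=
  Real.exp (-∫ u in (0 : ℝ)..R, 2 * Real.pi * p.lam k * u * p.linkProb ν u)

/-- The density of the distance from the user to the nearest base station of tier `k` with link
condition `ν`. -/
def nearestPDF (k : Tier) (ν : Link) (r : ℝ) : ℝ :=
  2 * Real.pi * p.lam k * r * p.linkProb ν r * p.voidProb k ν r

/-- The association density `F`: the density of the nearest base station of tier `k` and link
condition `ν` being at distance `r`, times the probabilities, for the three other combinations of
tier and link condition, that no base station of that combination is received more strongly. -/
def assocDensity (k : Tier) (ν : Link) (r : ℝ) : ℝ :=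
  p.nearestPDF k ν r *
    ∏ q ∈ (Finset.univ : Finset (Tier × Link)).erase (k, ν),
      p.voidProb q.1 q.2 (p.exclusionRadius k ν q.1 q.2 r)

end Params

/-- The number of points of the sequence `X` in `S`. -/
def pointCount {Ω : Type*} (X : ℕ → Ω → Plane) (S : Set Plane) (ω : Ω) : ℝ≥0∞ :=
  ∑' n, S.indicator (fun _ => (1 : ℝ≥0∞)) (X n ω)

/-- The random points `X 0, X 1, …` enumerate a homogeneous Poisson point process of density
`lam` on the plane: counts are Poisson, and independent on disjoint sets. -/
structure IsPoissonProcess {Ω : Type*} [MeasurableSpace Ω] (P : Measure Ω) (lam : ℝ)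
    (X : ℕ → Ω → Plane) : Prop where
  count_law : ∀ S : Set Plane, MeasurableSet S → volume S ≠ ∞ →
    P.map (pointCount X S) =
      (poissonMeasure (Real.toNNReal (lam * (volume S).toReal))).map (fun n : ℕ => (n : ℝ≥0∞))
  count_indep : ∀ (m : ℕ) (S : Fin m → Set Plane), (∀ i, MeasurableSet (S i)) →
    Pairwise (fun i j => Disjoint (S i) (S j)) → iIndepFun (fun i => pointCount X (S i)) P

/-- The random network, seen from a typical user located at the origin. -/
structure Network {Ω : Type*} [MeasurableSpace Ω] (P : Measure Ω) (p : Params) where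
  /-- location of the `n`-th base station of tier `k` -/
  X : Tier → ℕ → Ω → Plane
  /-- uniform variable that decides the link condition of the `n`-th base station of tier `k` -/
  U : Tier → ℕ → Ω → ℝ
  /-- small-scale fading power of the `n`-th base station of tier `k` -/
  h : Tier → ℕ → Ω → ℝ
  measurable_X : ∀ k n, Measurable (X k n)
  measurable_U : ∀ k n, Measurable (U k n)
  measurable_h : ∀ k n, Measurable (h k n)
  poisson : ∀ k, IsPoissonProcess P (p.lam k) (X k)
  U_law : ∀ k n, P.map (U k n) = volume.restrict (Icc (0 : ℝ) 1)
  /-- Rayleigh fading: the fading power is exponential of mean one -/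
  h_law : ∀ k n, P.map (h k n) = expMeasure 1
  /-- The two point processes, all the blockage variables and all the fading variables are
  mutually independent. -/
  indep : iIndep
    (Sum.elim (fun k : Tier => MeasurableSpace.comap (fun ω n => X k n ω) inferInstance)
      (Sum.elim (fun q : Tier × ℕ => MeasurableSpace.comap (U q.1 q.2) inferInstance)
        (fun q : Tier × ℕ => MeasurableSpace.comap (h q.1 q.2) inferInstance))) P

/-- `exp (-x)` on `[0, ∞]`, with value `0` at `∞`. -/
def expNeg (x : ℝ≥0∞) : ℝ := if x = ∞ then 0 else Real.exp (-x.toReal)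

namespace Network

variable {Ω : Type*} [MeasurableSpace Ω] {P : Measure Ω} {p : Params} (N : Network P p)

/-- Distance from the user to the `n`-th base station of tier `k`. -/
def dist (k : Tier) (n : ℕ) (ω : Ω) : ℝ := ‖N.X k n ω‖

/-- Link condition of the `n`-th base station of tier `k`: given the locations, line of sight with
probability `losProb` of the distance, independently over base stations. -/
def link (k : Tier) (n : ℕ) (ω : Ω) : Link :=
  if N.U k n ω ≤ p.losProb (N.dist k n ω) then Link.los else Link.nlos

/-- Biased received power (before fading) from the `n`-th base station of tier `k`. -/
def power (k : Tier) (n : ℕ) (ω : Ω) : ℝ := p.biasedPower k (N.link k n ω) (N.dist k n ω)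

/-- The `n`-th base station of tier `k` serves the user: its biased received power is maximal over
all the base stations of both tiers. -/
def Serves (k : Tier) (n : ℕ) (ω : Ω) : Prop := ∀ j i, N.power j i ω ≤ N.power k n ω

/-- Interference, when the `n`-th base station of tier `k` serves, from all the other base
stations of both tiers. -/
def interference (k : Tier) (n : ℕ) (ω : Ω) : ℝ≥0∞ :=
  ∑' q : Tier × ℕ,
    if q = (k, n) then 0 else ENNReal.ofReal (N.h q.1 q.2 ω * N.power q.1 q.2 ω)

/-- SINR of the user, when the `n`-th base station of tier `k` serves. -/
def SINR (k : Tier) (n : ℕ) (ω : Ω) : ℝ≥0∞ :=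
  ENNReal.ofReal (N.h k n ω * N.power k n ω) / (N.interference k n ω + ENNReal.ofReal p.N₀)

/-- SINR coverage probability with tier `k`: the user is served by tier `k` and its SINR exceeds
`γ`. -/
def covProb (k : Tier) (γ : ℝ) : ℝ :=
  P.real {ω | ∃ n, N.Serves k n ω ∧ ENNReal.ofReal γ < N.SINR k n ω}

/-- SINR coverage probability with tier `k` by a link of condition `ν`. -/
def covProbLink (k : Tier) (ν : Link) (γ : ℝ) : ℝ :=
  P.real {ω | ∃ n, N.Serves k n ω ∧ N.link k n ω = ν ∧ ENNReal.ofReal γ ≤ N.SINR k n ω}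

/-- Interference at the user given that it is served by tier `k` over a link of condition `ν` and
length `r`: the interferers are the base stations of the network that are not received more
strongly than the serving one. -/
def interferenceAt (k : Tier) (ν : Link) (r : ℝ) (ω : Ω) : ℝ≥0∞ :=
  ∑' q : Tier × ℕ,
    if N.power q.1 q.2 ω ≤ p.biasedPower k ν r then
      ENNReal.ofReal (N.h q.1 q.2 ω * N.power q.1 q.2 ω) else 0

/-- Laplace transform at `s` of the interference (in units of `Ptr k * B k * A ν`) given that the
user is served by tier `k` over a link of condition `ν` and length `r`. -/
def laplace (k : Tier) (ν : Link) (r s : ℝ) : ℝ :=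
  ∫ ω, expNeg (ENNReal.ofReal s *
    (N.interferenceAt k ν r ω / ENNReal.ofReal (p.Ptr k * p.B k * p.A ν))) ∂P

end Network

end MmWave

end

/-! The base stations, marked with their blockage variable and fading, form a Poisson process on
`Station` with intensity `Params.intensity` (`Network.hasPoissonLaplace`). The whole argument runs
on Laplace functionals: `HasPoissonLaplace` says E exp(-∑ w(Z_i)) = exp(-∫ (1 - e^{-w}) dΛ). It
follows from Poisson counts independent on disjoint sets and passes through superposition and
independent marking.

Replacing w by w + t·1_A and differentiating at t = 0 gives the Mecke formula for exponential
functionals. Since the served link length determines both which stations may interfere and the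
Laplace parameter, w must be allowed to depend on the distinguished point through its distance;
`tsum_lintegral_mul_negExp_param` gets this by discretising the distance from below.

The event that a given station serves is itself an exponential functional: `Params.exponent` is
infinite on stronger stations, so exp(-∑) is the indicator of service times the interference term
(`negExp_tsum_exponent`). After Mecke, stronger and weaker stations contribute separate factors
(`lintegral_negExp_exponent`). The stronger ones give the void probabilities, which together with
the radial intensity make up `assocDensity`; the weaker ones give `laplace`.
`tsum_lintegral_serving` records the result for an arbitrary weight and Laplace parameter, and all
three assertions of the theorem are instances of it.

For coverage, the serving fading is independent of locations, link conditions and the other fadings.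
Its exponential tail turns {SINR > γ} into exp(-γ(I + N₀)/power), which splits into a noise weight
and an interference functional (`measure_serving_SINR`). Summing over stations gives a probability
because ties in received power are null (`ae_serves_unique`), which comes from the second factorial
moment measure being Λ ⊗ Λ. -/

namespace MmWave

open Filter Topology

/-! ### The exponential of minus an extended nonnegative number -/

/-- `exp (-x)` for `x ∈ [0, ∞]`, as an extended nonnegative number. -/
noncomputable def negExp (x : ℝ≥0∞) : ℝ≥0∞ := EReal.exp (-(x : EReal))

@[simp] lemma negExp_zero : negExp 0 = 1 := by simp [negExp]

@[simp] lemma negExp_top : negExp ∞ = 0 := by simp [negExp]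

lemma negExp_ofReal {x : ℝ} (hx : 0 ≤ x) :
    negExp (ENNReal.ofReal x) = ENNReal.ofReal (Real.exp (-x)) := by
  rw [negExp, EReal.coe_ennreal_ofReal, max_eq_left hx, ← EReal.coe_neg, EReal.exp_coe]

lemma negExp_eq_ofReal_expNeg (x : ℝ≥0∞) : negExp x = ENNReal.ofReal (expNeg x) := by
  by_cases hx : x = ∞
  · simp [hx, expNeg]
  · rw [expNeg, if_neg hx, ← negExp_ofReal ENNReal.toReal_nonneg, ENNReal.ofReal_toReal hx]

lemma negExp_add (x y : ℝ≥0∞) : negExp (x + y) = negExp x * negExp y := by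
  rw [negExp, negExp, negExp, ← EReal.exp_add, EReal.coe_ennreal_add, EReal.neg_add, sub_eq_add_neg]
  · exact Or.inl (EReal.coe_ennreal_ne_bot x)
  · exact Or.inr (EReal.coe_ennreal_ne_bot y)

lemma negExp_antitone : Antitone negExp := fun x y h => by
  rw [negExp, negExp, EReal.exp_le_exp_iff, EReal.neg_le_neg_iff]
  exact_mod_cast h

lemma negExp_le_one (x : ℝ≥0∞) : negExp x ≤ 1 := by
  simpa using negExp_antitone (zero_le (a := x))

lemma negExp_ne_top (x : ℝ≥0∞) : negExp x ≠ ∞ :=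
  ne_top_of_le_ne_top ENNReal.one_ne_top (negExp_le_one x)

lemma negExp_eq_zero_iff {x : ℝ≥0∞} : negExp x = 0 ↔ x = ∞ := by
  rw [negExp, EReal.exp_eq_zero_iff, EReal.neg_eq_bot_iff, EReal.coe_ennreal_eq_top_iff]

lemma negExp_sum {ι : Type*} (s : Finset ι) (f : ι → ℝ≥0∞) :
    negExp (∑ i ∈ s, f i) = ∏ i ∈ s, negExp (f i) := by
  classical
  induction s using Finset.induction_on with
  | empty => simp
  | insert a s ha ih => rw [Finset.sum_insert ha, Finset.prod_insert ha, negExp_add, ih]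

lemma continuous_negExp : Continuous negExp := by
  have h : Continuous EReal.exp := by fun_prop
  exact h.comp (continuous_neg.comp continuous_coe_ennreal_ereal)

lemma measurable_negExp : Measurable negExp := continuous_negExp.measurable

@[fun_prop]
lemma measurable_negExp_comp {α : Type*} [MeasurableSpace α] {f : α → ℝ≥0∞} (hf : Measurable f) :
    Measurable (fun a => negExp (f a)) := measurable_negExp.comp hf

lemma measurable_expNeg : Measurable expNeg := by
  have : expNeg = fun x => (negExp x).toReal := by
    funext x
    rw [negExp_eq_ofReal_expNeg, ENNReal.toReal_ofReal]
    unfold expNeg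
    split_ifs <;> positivity
  rw [this]
  exact measurable_negExp.ennreal_toReal

/-- Every number in `[0, 1]` is of the form `exp (-x)`. -/
noncomputable def negLog (y : ℝ≥0∞) : ℝ≥0∞ := (-(ENNReal.log y)).toENNReal

lemma negExp_negLog {y : ℝ≥0∞} (hy : y ≤ 1) : negExp (negLog y) = y := by
  rw [negExp, negLog, EReal.coe_toENNReal, neg_neg]
  · exact ENNReal.exp_log y
  · rw [EReal.neg_nonneg]
    exact ENNReal.log_le_zero_iff.2 hy

lemma measurable_negLog : Measurable negLog := by
  unfold negLog
  have : Measurable ENNReal.log := ENNReal.measurable_log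
  exact (continuous_neg.measurable.comp this).ereal_toENNReal

lemma tendsto_negExp_sum {ι : Type*} (f : ι → ℝ≥0∞) :
    Tendsto (fun s : Finset ι => ∏ i ∈ s, negExp (f i)) atTop (𝓝 (negExp (∑' i, f i))) := by
  simp_rw [← negExp_sum]
  exact (continuous_negExp.tendsto _).comp ENNReal.summable.hasSum

/-! ### Expectations from the derivative of a Laplace transform at zero -/

lemma tendsto_diffQuot_real {g : ℝ → ℝ} {M : ℝ} (hg : HasDerivAt g M 0) (h0 : g 0 = 1) :
    Tendsto (fun n : ℕ => ((n : ℝ) + 1) * (g (1 / ((n : ℝ) + 1)) - 1)) atTop (𝓝 M) := by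
  have h := hg.tendsto_slope_zero_right
  have ht : Tendsto (fun n : ℕ => 1 / ((n : ℝ) + 1)) atTop (𝓝[>] 0) := by
    rw [tendsto_nhdsWithin_iff]
    exact ⟨tendsto_one_div_add_atTop_nhds_zero_nat,
      Eventually.of_forall fun n => by simp only [mem_Ioi]; positivity⟩
  refine (h.comp ht).congr fun n => ?_
  simp [h0]

/-- `(1 - exp (-φ (t) x)) / t → x` as `t → 0` along `1 / (n + 1)`. -/
lemma tendsto_diffQuot {φ : ℝ → ℝ} (hφ : HasDerivAt φ 1 0) (h0 : φ 0 = 0)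
    (hpos : ∀ t, 0 < t → 0 < φ t) (x : ℝ≥0∞) :
    Tendsto (fun n : ℕ => ((n : ℝ≥0∞) + 1) *
      (1 - negExp (ENNReal.ofReal (φ (1 / ((n : ℝ) + 1))) * x))) atTop (𝓝 x) := by
  have hp : ∀ n : ℕ, 0 < φ (1 / ((n : ℝ) + 1)) := fun n => hpos _ (by positivity)
  by_cases hx : x = ∞
  · subst hx
    have : ∀ n : ℕ, ENNReal.ofReal (φ (1 / ((n : ℝ) + 1))) * ∞ = ∞ := fun n =>
      ENNReal.mul_top (by simpa using hp n)
    simp only [this, negExp_top, tsub_zero, mul_one]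
    exact tendsto_nhds_top_mono' ENNReal.tendsto_nat_nhds_top (fun n => le_self_add)
  · have h1 : HasDerivAt (fun t => Real.exp (-(φ t * x.toReal))) (-x.toReal) 0 := by
      have := ((hφ.mul_const x.toReal).neg).exp
      simpa [h0] using this
    have h2 := (tendsto_diffQuot_real h1 (by simp [h0])).neg
    rw [neg_neg] at h2
    have h3 := (ENNReal.continuous_ofReal.tendsto _).comp h2
    rw [ENNReal.ofReal_toReal hx] at h3
    refine h3.congr fun n => ?_
    have e : ENNReal.ofReal (φ (1 / ((n : ℝ) + 1))) * x =
        ENNReal.ofReal (φ (1 / ((n : ℝ) + 1)) * x.toReal) := by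
      rw [ENNReal.ofReal_mul (hp n).le, ENNReal.ofReal_toReal hx]
    rw [e, negExp_ofReal (mul_nonneg (hp n).le ENNReal.toReal_nonneg), ← ENNReal.ofReal_one,
      ← ENNReal.ofReal_sub _ (Real.exp_pos _).le, ← ENNReal.ofReal_natCast,
      ← ENNReal.ofReal_add (by positivity) (by positivity), ← ENNReal.ofReal_mul (by positivity)]
    simp only [Function.comp]
    congr 1; ring

lemma one_sub_negExp_le (x : ℝ≥0∞) : 1 - negExp x ≤ x := by
  by_cases hx : x = ∞
  · simp [hx]
  · rw [← ENNReal.ofReal_toReal hx, negExp_ofReal ENNReal.toReal_nonneg, ← ENNReal.ofReal_one,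
      ← ENNReal.ofReal_sub _ (Real.exp_pos _).le]
    apply ENNReal.ofReal_le_ofReal
    have := Real.add_one_le_exp (-x.toReal)
    linarith

/-- Differentiation at `0` of a Laplace transform of Poisson type. -/
lemma lintegral_of_laplace {α : Type*} [MeasurableSpace α] {μ : Measure α} {G : α → ℝ≥0∞}
    (hG : Measurable G) {c M : ℝ≥0∞} (hc : c ≠ ∞)
    (h : ∀ t : ℝ, 0 ≤ t → ∫⁻ a, negExp (ENNReal.ofReal t * G a) ∂μ =
      c * negExp (ENNReal.ofReal (1 - Real.exp (-t)) * M)) :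
    ∫⁻ a, G a ∂μ = c * M := by
  have huniv : μ univ = c := by simpa using h 0 le_rfl
  -- Both φ(t) = 1 - exp(-t), used here, and φ = id, used under the integral, have derivative 1 at
  -- 0, so the two difference quotients tend to M and to G.
  have hR : Tendsto (fun n : ℕ => c * (((n : ℝ≥0∞) + 1) *
      (1 - negExp (ENNReal.ofReal (1 - Real.exp (-(1 / ((n : ℝ) + 1)))) * M)))) atTop
      (𝓝 (c * M)) := by
    apply ENNReal.Tendsto.const_mul _ (Or.inr hc)
    refine tendsto_diffQuot (φ := fun t => 1 - Real.exp (-t)) ?_ (by simp) ?_ M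
    · have := ((hasDerivAt_id (0 : ℝ)).neg.exp).const_sub 1
      simpa using this
    · intro t ht
      have : Real.exp (-t) < 1 := by rw [Real.exp_lt_one_iff]; linarith
      simp only [sub_pos, this]
  have hE : ∀ n : ℕ, ∫⁻ a, ((n : ℝ≥0∞) + 1) *
      (1 - negExp (ENNReal.ofReal (id (1 / ((n : ℝ) + 1))) * G a)) ∂μ =
      c * (((n : ℝ≥0∞) + 1) *
      (1 - negExp (ENNReal.ofReal (1 - Real.exp (-(1 / ((n : ℝ) + 1)))) * M))) := by
    intro n
    have hm : Measurable fun a => negExp (ENNReal.ofReal (id (1 / ((n : ℝ) + 1))) * G a) := by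
      fun_prop
    rw [lintegral_const_mul _ (by fun_prop), lintegral_sub hm _
      (Eventually.of_forall fun a => negExp_le_one _)]
    · simp only [id]
      rw [h _ (by positivity), lintegral_const, huniv, one_mul, mul_left_comm,
        ENNReal.mul_sub (fun _ _ => hc), mul_one]
    · simp only [id]
      rw [h _ (by positivity)]
      exact ENNReal.mul_ne_top hc (negExp_ne_top _)
  apply le_antisymm
  -- Fatou bounds ∫ G above; the reverse inequality uses 1 - e^{-x} ≤ x. Neither needs ∫ G or M to
  -- be finite.
  · calc ∫⁻ a, G a ∂μ = ∫⁻ a, liminf (fun n : ℕ => ((n : ℝ≥0∞) + 1) *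
          (1 - negExp (ENNReal.ofReal (id (1 / ((n : ℝ) + 1))) * G a))) atTop ∂μ := by
          refine lintegral_congr fun a => ?_
          exact (tendsto_diffQuot (hasDerivAt_id 0) rfl (fun t ht => ht) (G a)).liminf_eq.symm
      _ ≤ liminf (fun n : ℕ => ∫⁻ a, ((n : ℝ≥0∞) + 1) *
          (1 - negExp (ENNReal.ofReal (id (1 / ((n : ℝ) + 1))) * G a)) ∂μ) atTop :=
          lintegral_liminf_le fun n => by fun_prop
      _ = c * M := by simp_rw [hE]; exact hR.liminf_eq
  · refine le_of_tendsto hR (Eventually.of_forall fun n => ?_)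
    rw [← hE n]
    refine lintegral_mono fun a => ?_
    calc ((n : ℝ≥0∞) + 1) * (1 - negExp (ENNReal.ofReal (id (1 / ((n : ℝ) + 1))) * G a))
        ≤ ((n : ℝ≥0∞) + 1) * (ENNReal.ofReal (id (1 / ((n : ℝ) + 1))) * G a) := by
          gcongr; exact one_sub_negExp_le _
      _ = G a := by
          rw [← mul_assoc, ← ENNReal.ofReal_natCast, ← ENNReal.ofReal_one,
            ← ENNReal.ofReal_add (by positivity) (by positivity),
            ← ENNReal.ofReal_mul (by positivity)]
          have : ((n : ℝ) + 1) * id (1 / ((n : ℝ) + 1)) = 1 := by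
            simp only [id]; field_simp
          rw [this]; simp

/-! ### Laplace functional of a Poisson process -/

/-- The Laplace functional of the random points `Z i` is that of a Poisson process with intensity
measure `Λ`. -/
def HasPoissonLaplace {Ω E ι : Type*} [MeasurableSpace Ω] [MeasurableSpace E] (P : Measure Ω)
    (Z : ι → Ω → E) (Λ : Measure E) : Prop :=
  ∀ w : E → ℝ≥0∞, Measurable w →
    ∫⁻ ω, negExp (∑' i, w (Z i ω)) ∂P = negExp (∫⁻ z, (1 - negExp (w z)) ∂Λ)

/-- The generating function of the Poisson law: summing against e^{-cn} turns the series of e^m into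
that of exp(m e^{-c}). -/
lemma lintegral_negExp_poisson {m c : ℝ} (hm : 0 ≤ m) (hc : 0 ≤ c) :
    ∫⁻ n : ℕ, negExp (ENNReal.ofReal c * n) ∂(poissonMeasure (Real.toNNReal m)) =
      negExp (ENNReal.ofReal (m * (1 - Real.exp (-c)))) := by
  have hexp : Real.exp (-c) ≤ 1 := by rw [Real.exp_le_one_iff]; linarith
  rw [poissonMeasure, lintegral_sum_measure]
  simp_rw [lintegral_smul_measure, lintegral_dirac, Real.coe_toNNReal m hm]
  rw [negExp_ofReal (mul_nonneg hm (by linarith))]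
  have h1 : ∀ n : ℕ, ENNReal.ofReal (Real.exp (-m) * m ^ n / (n.factorial : ℝ)) •
      negExp (ENNReal.ofReal c * (n : ℝ≥0∞)) =
      ENNReal.ofReal (Real.exp (-m) * ((m * Real.exp (-c)) ^ n / (n.factorial : ℝ))) := by
    intro n
    rw [← ENNReal.ofReal_natCast, ← ENNReal.ofReal_mul hc, negExp_ofReal (by positivity),
      smul_eq_mul, ← ENNReal.ofReal_mul (by positivity)]
    congr 1
    have : Real.exp (-(c * n)) = Real.exp (-c) ^ n := by
      rw [← Real.exp_nat_mul]; congr 1; ring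
    rw [this, mul_pow]; ring
  simp_rw [h1]
  have h2 : HasSum (fun n : ℕ => Real.exp (-m) * ((m * Real.exp (-c)) ^ n / (n.factorial : ℝ)))
      (Real.exp (-m) * Real.exp (m * Real.exp (-c))) := by
    have := (NormedSpace.expSeries_div_hasSum_exp (m * Real.exp (-c))).mul_left (Real.exp (-m))
    rwa [← Real.exp_eq_exp_ℝ] at this
  rw [← ENNReal.ofReal_tsum_of_nonneg (fun n => by positivity) h2.summable, h2.tsum_eq,
    ← Real.exp_add]
  congr 2; ring

section

variable {Ω : Type*} [MeasurableSpace Ω] {P : Measure Ω} {lam : ℝ} {X : ℕ → Ω → Plane}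

lemma measurable_pointCount (hX : ∀ n, Measurable (X n)) {S : Set Plane} (hS : MeasurableSet S) :
    Measurable (pointCount X S) := by
  unfold pointCount
  exact Measurable.tsum fun n => (measurable_const.indicator hS).comp (hX n)

lemma IsPoissonProcess.laplace_count (h : IsPoissonProcess P lam X) (hlam : 0 ≤ lam)
    (hX : ∀ n, Measurable (X n)) {S : Set Plane} (hS : MeasurableSet S) (hv : volume S ≠ ∞)
    {c : ℝ≥0∞} (hc : c ≠ ∞) :
    ∫⁻ ω, negExp (c * pointCount X S ω) ∂P =
      negExp ((1 - negExp c) * (ENNReal.ofReal lam * volume S)) := by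
  have hmeas : Measurable fun x : ℝ≥0∞ => negExp (c * x) := by fun_prop
  rw [← lintegral_map hmeas (measurable_pointCount hX hS), h.count_law S hS hv,
    lintegral_map hmeas (measurable_of_countable _)]
  lift c to NNReal using hc
  have := lintegral_negExp_poisson (m := lam * (volume S).toReal) (c := c)
    (mul_nonneg hlam ENNReal.toReal_nonneg) c.2
  rw [ENNReal.ofReal_coe_nnreal] at this
  rw [this]
  congr 1
  rw [ENNReal.ofReal_mul (mul_nonneg hlam ENNReal.toReal_nonneg), ENNReal.ofReal_mul hlam,
    ENNReal.ofReal_toReal hv, ENNReal.ofReal_sub _ (Real.exp_pos _).le, ENNReal.ofReal_one,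
    ← negExp_ofReal c.coe_nonneg,
    ENNReal.ofReal_coe_nnreal, mul_comm]

/-- The arbitrary φ vanishing at 0 lets one decomposition over the nonzero levels serve both f
itself and 1 - e^{-f}. -/
lemma simpleFunc_eq_sum_indicator {E : Type*} [MeasurableSpace E] (f : SimpleFunc E ℝ≥0∞) :
    ∃ (m : ℕ) (c : Fin m → ℝ≥0∞), (∀ i, c i ≠ 0 ∧ c i ∈ f.range) ∧ Function.Injective c ∧
      ∀ φ : ℝ≥0∞ → ℝ≥0∞, φ 0 = 0 →
        ∀ z, φ (f z) = ∑ i, φ (c i) * (f ⁻¹' {c i}).indicator (fun _ => 1) z := by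
  classical
  set s := f.range.filter (· ≠ 0)
  refine ⟨s.card, fun i => (s.equivFin.symm i : ℝ≥0∞), fun i => ?_, ?_, ?_⟩
  · have := (s.equivFin.symm i).2
    rw [Finset.mem_filter] at this
    exact ⟨this.2, this.1⟩
  · exact Subtype.val_injective.comp s.equivFin.symm.injective
  · intro φ h0 z
    rw [Equiv.sum_comp s.equivFin.symm
      (fun y : s => φ (y : ℝ≥0∞) * (f ⁻¹' {(y : ℝ≥0∞)}).indicator (fun _ => (1 : ℝ≥0∞)) z),
      Finset.sum_coe_sort s
      (fun y => φ y * (f ⁻¹' {y}).indicator (fun _ => (1 : ℝ≥0∞)) z)]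
    simp only [indicator_apply, mem_preimage, mem_singleton_iff, mul_ite, mul_one, mul_zero]
    rw [Finset.sum_ite_eq]
    split_ifs with hz
    · rfl
    · have : f z = 0 := by
        by_contra hne
        exact hz (Finset.mem_filter.2 ⟨f.mem_range_self z, hne⟩)
      rw [this, h0]

/-- The nonzero level sets are disjoint with finite volume, so ∑ f(X_n) is a linear combination of
independent Poisson counts and the expectation factors. -/
lemma IsPoissonProcess.laplace_simpleFunc (h : IsPoissonProcess P lam X) (hlam : 0 ≤ lam)
    (hX : ∀ n, Measurable (X n)) (f : SimpleFunc Plane ℝ≥0∞) (hf : ∀ z, f z ≠ ∞)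
    (hv : volume {z | f z ≠ 0} ≠ ∞) :
    ∫⁻ ω, negExp (∑' n, f (X n ω)) ∂P =
      negExp (∫⁻ z, (1 - negExp (f z)) ∂(ENNReal.ofReal lam • volume)) := by
  obtain ⟨m, c, hc, hinj, hφ⟩ := simpleFunc_eq_sum_indicator f
  have hS : ∀ i, MeasurableSet (f ⁻¹' {c i}) := fun i => f.measurableSet_preimage _
  have hvS : ∀ i, volume (f ⁻¹' {c i}) ≠ ∞ := fun i => by
    refine ne_top_of_le_ne_top hv (measure_mono fun z hz => ?_)
    simp only [mem_preimage, mem_singleton_iff] at hz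
    simpa [hz] using (hc i).1
  have hcf : ∀ i, c i ≠ ∞ := fun i => by
    obtain ⟨z, hz⟩ := SimpleFunc.mem_range.1 (hc i).2
    rw [← hz]; exact hf z
  have hsum : ∀ ω, ∑' n, f (X n ω) = ∑ i, c i * pointCount X (f ⁻¹' {c i}) ω := by
    intro ω
    have : ∀ n, f (X n ω) = ∑ i, c i * (f ⁻¹' {c i}).indicator (fun _ => 1) (X n ω) :=
      fun n => hφ id rfl _
    simp_rw [this, pointCount, ← ENNReal.tsum_mul_left]
    exact Summable.tsum_finsetSum fun i _ => ENNReal.summable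
  have hind := h.count_indep m (fun i => f ⁻¹' {c i}) hS (fun i j hij => by
    refine Disjoint.preimage _ ?_
    rw [disjoint_singleton]
    exact hinj.ne hij)
  have hind' := hind.comp (fun i x => negExp (c i * x)) (fun i => by fun_prop)
  simp_rw [hsum, negExp_sum]
  have := lintegral_prod_eq_prod_lintegral_of_indepFun Finset.univ _ hind' fun i =>
    (measurable_negExp_comp (f := fun x => c i * x) (by fun_prop)).comp
      (measurable_pointCount hX (hS i))
  simp only [Function.comp] at this
  rw [this]
  simp_rw [fun i => h.laplace_count hlam hX (hS i) (hvS i) (hcf i), ← negExp_sum]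
  congr 1
  simp_rw [hφ (fun y => 1 - negExp y) (by simp)]
  rw [lintegral_smul_measure, lintegral_finsetSum _ (fun i _ =>
    (measurable_const.indicator (hS i)).const_mul _), smul_eq_mul, Finset.mul_sum]
  refine Finset.sum_congr rfl fun i _ => ?_
  rw [lintegral_const_mul _ (measurable_const.indicator (hS i)), lintegral_indicator (hS i)]
  simp only [lintegral_const, MeasurableSet.univ, Measure.restrict_apply, univ_inter, one_mul]
  ring

/-- Monotone approximation of w: the truncation to balls gives finite-volume supports, and `eapprox`
gives finite values, as the simple-function case requires. -/
lemma IsPoissonProcess.hasPoissonLaplace [IsProbabilityMeasure P] (h : IsPoissonProcess P lam X)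
    (hlam : 0 ≤ lam) (hX : ∀ n, Measurable (X n)) :
    HasPoissonLaplace P X (ENNReal.ofReal lam • volume) := by
  intro w hw
  set f : ℕ → SimpleFunc Plane ℝ≥0∞ := fun j =>
    (SimpleFunc.eapprox w j).restrict (Metric.closedBall 0 j) with hfdef
  have hfa : ∀ j z, f j z = (Metric.closedBall (0 : Plane) j).indicator (SimpleFunc.eapprox w j) z :=
    fun j z => by
      rw [hfdef, SimpleFunc.restrict_apply _ Metric.isClosed_closedBall.measurableSet]
  have hmono : ∀ z, Monotone fun j => f j z := by
    intro z i j hij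
    simp only [hfa]
    refine (indicator_le_indicator_of_subset (Metric.closedBall_subset_closedBall
      (Nat.cast_le.2 hij)) (fun _ => zero_le) z).trans ?_
    exact indicator_le_indicator (SimpleFunc.monotone_eapprox w hij z)
  have hlim : ∀ z, Tendsto (fun j => f j z) atTop (𝓝 (w z)) := by
    intro z
    refine (SimpleFunc.tendsto_eapprox hw z).congr' ?_
    obtain ⟨J, hJ⟩ := exists_nat_ge ‖z‖
    filter_upwards [eventually_ge_atTop J] with j hj
    rw [hfa, indicator_of_mem]
    rw [mem_closedBall_zero_iff]
    exact hJ.trans (by exact_mod_cast hj)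
  have hle : ∀ j z, f j z ≤ w z := fun j z => (hmono z).ge_of_tendsto (hlim z) j
  have hj := fun j => h.laplace_simpleFunc hlam hX (f j)
    (fun z => by
      rw [hfa]
      by_cases hz : z ∈ Metric.closedBall (0 : Plane) j
      · rw [indicator_of_mem hz]; exact (SimpleFunc.eapprox_lt_top w j z).ne
      · rw [indicator_of_notMem hz]; simp)
    (by
      refine ne_top_of_le_ne_top (measure_closedBall_lt_top (x := (0 : Plane)) (r := j)).ne
        (measure_mono fun z hz => ?_)
      by_contra hn
      exact hz (by rw [hfa, indicator_of_notMem hn]))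
  have hlimsum : ∀ ω, Tendsto (fun j => ∑' n, f j (X n ω)) atTop (𝓝 (∑' n, w (X n ω))) := by
    intro ω
    simp_rw [← lintegral_count]
    exact lintegral_tendsto_of_tendsto_of_monotone (fun j => (measurable_of_countable _).aemeasurable)
      (Eventually.of_forall fun n => hmono _) (Eventually.of_forall fun n => hlim _)
  have hL : Tendsto (fun j => ∫⁻ ω, negExp (∑' n, f j (X n ω)) ∂P) atTop
      (𝓝 (∫⁻ ω, negExp (∑' n, w (X n ω)) ∂P)) := by
    refine tendsto_lintegral_of_dominated_convergence (fun _ => 1) (fun j => ?_)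
      (fun j => Eventually.of_forall fun ω => negExp_le_one _) (by simp)
      (Eventually.of_forall fun ω => (continuous_negExp.tendsto _).comp (hlimsum ω))
    exact measurable_negExp.comp (Measurable.tsum fun n => (f j).measurable.comp (hX n))
  have hR : Tendsto (fun j => ∫⁻ z, (1 - negExp (f j z)) ∂(ENNReal.ofReal lam • volume)) atTop
      (𝓝 (∫⁻ z, (1 - negExp (w z)) ∂(ENNReal.ofReal lam • volume))) := by
    refine lintegral_tendsto_of_tendsto_of_monotone (fun j => ?_) ?_ ?_
    · exact (measurable_const.sub (measurable_negExp.comp (f j).measurable)).aemeasurable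
    · exact Eventually.of_forall fun z i j hij =>
        tsub_le_tsub_left (negExp_antitone (hmono z hij)) _
    · exact Eventually.of_forall fun z => ENNReal.Tendsto.sub tendsto_const_nhds
        ((continuous_negExp.tendsto _).comp (hlim z)) (Or.inl ENNReal.one_ne_top)
  simp_rw [hj] at hL
  exact tendsto_nhds_unique hL ((continuous_negExp.tendsto _).comp hR)

end

/-! ### Superposition and independent marking -/

/-- Fubini in freezing form: the joint law is a product, so the independent variable can be
integrated out first. It serves both to average marks and to average the serving fading. -/
lemma lintegral_comp_prodMk_of_indep {Ω : Type*} {m mΩ : MeasurableSpace Ω} {P : Measure Ω}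
    [IsProbabilityMeasure P] {E F : Type*} [MeasurableSpace E] [MeasurableSpace F] (hm : m ≤ mΩ)
    {Y : Ω → F} (hY : Measurable Y)
    (hind : Indep m (MeasurableSpace.comap Y inferInstance) P) {W : Ω → E} (hW : Measurable[m] W)
    {φ : E × F → ℝ≥0∞} (hφ : Measurable φ) :
    ∫⁻ ω, φ (W ω, Y ω) ∂P = ∫⁻ ω, ∫⁻ y, φ (W ω, y) ∂(P.map Y) ∂P := by
  have hW' : Measurable W := hW.mono hm le_rfl
  have hi : IndepFun W Y P := indep_of_indep_of_le_left hind hW.comap_le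
  rw [indepFun_iff_map_prod_eq_prod_map_map hW'.aemeasurable hY.aemeasurable] at hi
  have := Measure.isProbabilityMeasure_map (μ := P) hY.aemeasurable
  rw [← lintegral_map (f := φ) hφ (hW'.prodMk hY), hi, lintegral_prod _ hφ.aemeasurable,
    lintegral_map hφ.lintegral_prod_right' hW']

section

variable {Ω : Type*} [MeasurableSpace Ω] {P : Measure Ω}

/-- Superposition of independent Poisson processes. -/
lemma HasPoissonLaplace.superpose {κ ι E : Type*} [Fintype κ] [MeasurableSpace κ]
    [MeasurableSpace E] [Countable ι] {X : κ → ι → Ω → E} {Λ : κ → Measure E}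
    (hX : ∀ k i, Measurable (X k i)) (h : ∀ k, HasPoissonLaplace P (X k) (Λ k))
    (hind : iIndepFun (fun k ω i => X k i ω) P) :
    HasPoissonLaplace P (fun (q : κ × ι) ω => (q.1, X q.1 q.2 ω))
      (Measure.sum fun k => (Λ k).map (Prod.mk k)) := by
  intro w hw
  have hw' : ∀ k, Measurable fun x => w (k, x) := fun k => hw.comp measurable_prodMk_left
  have hg : ∀ k, Measurable fun x : ι → E => negExp (∑' i, w (k, x i)) := fun k =>
    measurable_negExp.comp (Measurable.tsum fun i => (hw' k).comp (measurable_pi_apply i))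
  have h1 : ∀ ω, negExp (∑' q : κ × ι, w (q.1, X q.1 q.2 ω)) =
      ∏ k, negExp (∑' i, w (k, X k i ω)) := fun ω => by
    rw [ENNReal.tsum_prod' (f := fun q : κ × ι => w (q.1, X q.1 q.2 ω)), tsum_fintype, negExp_sum]
  simp_rw [h1]
  have := lintegral_prod_eq_prod_lintegral_of_indepFun Finset.univ _
    (hind.comp (fun k x => negExp (∑' i, w (k, x i))) hg)
    fun k => (hg k).comp (measurable_pi_lambda _ fun i => hX k i)
  simp only [Function.comp] at this
  rw [this]
  simp_rw [fun k => h k _ (hw' k), ← negExp_sum]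
  congr 1
  rw [lintegral_sum_measure, tsum_fintype]
  refine Finset.sum_congr rfl fun k _ => ?_
  rw [lintegral_map (by fun_prop) measurable_prodMk_left]

/-- Independent marking of a Poisson process. -/
lemma HasPoissonLaplace.marked [IsProbabilityMeasure P] {ι E F : Type*} [Countable ι]
    [MeasurableSpace E] [MeasurableSpace F] {X : ι → Ω → E} {Y : ι → Ω → F} {Λ : Measure E}
    {μ : Measure F} [IsProbabilityMeasure μ] (h : HasPoissonLaplace P X Λ)
    (hX : ∀ i, Measurable (X i)) (hY : ∀ i, Measurable (Y i)) (hμ : ∀ i, P.map (Y i) = μ)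
    (m : ι → MeasurableSpace Ω) (hm : ∀ i, m i ≤ ‹MeasurableSpace Ω›)
    (hXm : ∀ i j, Measurable[m i] (X j)) (hYm : ∀ i j, j ≠ i → Measurable[m i] (Y j))
    (hind : ∀ i, Indep (m i) (MeasurableSpace.comap (Y i) inferInstance) P) :
    HasPoissonLaplace P (fun i ω => (X i ω, Y i ω)) (Λ.prod μ) := by
  classical
  intro w hw
  set ψ : E → ℝ≥0∞ := fun x => ∫⁻ y, negExp (w (x, y)) ∂μ with hψdef
  have hψ : Measurable ψ := (measurable_negExp.comp hw).lintegral_prod_right'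
  have hψ1 : ∀ x, ψ x ≤ 1 := fun x => by
    calc ψ x ≤ ∫⁻ _, 1 ∂μ := lintegral_mono fun y => negExp_le_one _
      _ = 1 := by simp
  -- Marks are averaged one at a time; `T'` collects the points whose mark factor has already been
  -- replaced by its mean ψ.
  have key : ∀ T T' : Finset ι, Disjoint T T' →
      ∫⁻ ω, (∏ i ∈ T, negExp (w (X i ω, Y i ω))) * ∏ i ∈ T', ψ (X i ω) ∂P =
      ∫⁻ ω, (∏ i ∈ T, ψ (X i ω)) * ∏ i ∈ T', ψ (X i ω) ∂P := by
    intro T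
    induction T using Finset.induction_on with
    | empty => simp
    | insert a T ha ih =>
      intro T' hT
      rw [Finset.disjoint_insert_left] at hT
      set f : Ω → ℝ≥0∞ := fun ω => (∏ i ∈ T, negExp (w (X i ω, Y i ω))) * ∏ i ∈ T', ψ (X i ω)
      have hf : Measurable[m a] f := by
        refine Measurable.mul (Finset.measurable_fun_prod _ fun i hi => ?_)
          (Finset.measurable_fun_prod _ fun i _ => hψ.comp (hXm a i))
        exact (measurable_negExp.comp hw).comp
          ((hXm a i).prodMk (hYm a i (fun e => ha (e ▸ hi))))
      have h1 := lintegral_comp_prodMk_of_indep (P := P) (hm a) (hY a) (hind a)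
        (W := fun ω => (f ω, X a ω)) (hf.prodMk (hXm a a))
        (φ := fun q : (ℝ≥0∞ × E) × F => q.1.1 * negExp (w (q.1.2, q.2))) (by fun_prop)
      simp only [hμ] at h1
      have h2 : ∀ ω, ∫⁻ y, f ω * negExp (w (X a ω, y)) ∂μ = f ω * ψ (X a ω) := fun ω => by
        rw [lintegral_const_mul _ (by fun_prop)]
      simp_rw [h2] at h1
      calc ∫⁻ ω, (∏ i ∈ insert a T, negExp (w (X i ω, Y i ω))) * ∏ i ∈ T', ψ (X i ω) ∂P
          = ∫⁻ ω, f ω * negExp (w (X a ω, Y a ω)) ∂P := by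
            refine lintegral_congr fun ω => ?_
            rw [Finset.prod_insert ha]; simp only [f]; ring
        _ = ∫⁻ ω, f ω * ψ (X a ω) ∂P := h1
        _ = ∫⁻ ω, (∏ i ∈ T, negExp (w (X i ω, Y i ω))) * ∏ i ∈ insert a T', ψ (X i ω) ∂P := by
            refine lintegral_congr fun ω => ?_
            rw [Finset.prod_insert hT.1]; simp only [f]; ring
        _ = ∫⁻ ω, (∏ i ∈ T, ψ (X i ω)) * ∏ i ∈ insert a T', ψ (X i ω) ∂P :=
            ih _ (Finset.disjoint_insert_right.2 ⟨ha, hT.2⟩)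
        _ = _ := by
            refine lintegral_congr fun ω => ?_
            rw [Finset.prod_insert hT.1, Finset.prod_insert ha]; ring
  have hlim : ∀ g : Ω → ι → ℝ≥0∞, (∀ i, Measurable fun ω => g ω i) →
      Tendsto (fun T : Finset ι => ∫⁻ ω, ∏ i ∈ T, negExp (g ω i) ∂P) atTop
        (𝓝 (∫⁻ ω, negExp (∑' i, g ω i) ∂P)) := by
    intro g hg
    refine tendsto_lintegral_filter_of_dominated_convergence (fun _ => 1)
      (Eventually.of_forall fun T => ?_) (Eventually.of_forall fun T => ?_) (by simp)
      (Eventually.of_forall fun ω => tendsto_negExp_sum _)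
    · exact Finset.measurable_fun_prod _ fun i _ => measurable_negExp.comp (hg i)
    · exact Eventually.of_forall fun ω => Finset.prod_le_one' fun i _ => negExp_le_one _
  have hA := hlim (fun ω i => w (X i ω, Y i ω)) fun i => hw.comp ((hX i).prodMk (hY i))
  -- Writing ψ as exp(-`negLog` ψ) makes the averaged product an exponential functional of the
  -- unmarked points, to which `h` applies.
  have hB := hlim (fun ω i => negLog (ψ (X i ω))) fun i =>
    measurable_negLog.comp (hψ.comp (hX i))
  have hAB : ∀ T : Finset ι, ∫⁻ ω, ∏ i ∈ T, negExp (w (X i ω, Y i ω)) ∂P =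
      ∫⁻ ω, ∏ i ∈ T, negExp (negLog (ψ (X i ω))) ∂P := fun T => by
    simpa [negExp_negLog (hψ1 _)] using key T ∅ (Finset.disjoint_empty_right T)
  simp_rw [hAB] at hA
  have hE := tendsto_nhds_unique hA hB
  refine hE.trans ((h (fun x => negLog (ψ x)) (measurable_negLog.comp hψ)).trans ?_)
  congr 1
  rw [lintegral_prod _ (by fun_prop)]
  refine lintegral_congr fun x => ?_
  rw [negExp_negLog (hψ1 x), lintegral_sub (by fun_prop)
    (ne_top_of_le_ne_top ENNReal.one_ne_top (hψ1 x))
    (Eventually.of_forall fun y => negExp_le_one _)]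
  simp [hψdef]

end

/-! ### Mecke and Campbell formulas, and pairs of points -/

lemma tsum_eq_add_tsum_ne {ι : Type*} [DecidableEq ι] (f : ι → ℝ≥0∞) (i : ι) :
    ∑' q, f q = f i + ∑' q, if q = i then 0 else f q :=
  ENNReal.summable.tsum_eq_add_tsum_ite' i

lemma lintegral_withDensity_eq {α : Type*} [MeasurableSpace α] {μ : Measure α} {f g : α → ℝ≥0∞}
    (hf : Measurable f) (hg : Measurable g) :
    ∫⁻ a, g a ∂(μ.withDensity f) = ∫⁻ a, f a * g a ∂μ :=
  lintegral_withDensity_eq_lintegral_mul μ hf hg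

namespace HasPoissonLaplace

variable {Ω E ι : Type*} [MeasurableSpace Ω] [MeasurableSpace E] [Countable ι] {P : Measure Ω}
  {Z : ι → Ω → E} {Λ : Measure E}

/-- The Mecke formula for an indicator: the Laplace functional at w + t·1_A is the Laplace transform
of the count of A under the measure weighted by exp(-∑ w), and its derivative at t = 0 is read off.
-/
lemma lintegral_negExp_mul_count (h : HasPoissonLaplace P Z Λ) (hZ : ∀ i, Measurable (Z i))
    {w : E → ℝ≥0∞} (hw : Measurable w) {A : Set E} (hA : MeasurableSet A) :
    ∫⁻ ω, negExp (∑' i, w (Z i ω)) * ∑' i, A.indicator (fun _ => 1) (Z i ω) ∂P =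
      (∫⁻ ω, negExp (∑' i, w (Z i ω)) ∂P) * ∫⁻ z in A, negExp (w z) ∂Λ := by
  have hA' : Measurable (A.indicator (fun _ => (1 : ℝ≥0∞))) := measurable_const.indicator hA
  have hW : Measurable fun ω => ∑' i, w (Z i ω) := Measurable.tsum fun i => hw.comp (hZ i)
  have hG : Measurable fun ω => ∑' i, A.indicator (fun _ => (1 : ℝ≥0∞)) (Z i ω) :=
    Measurable.tsum fun i => hA'.comp (hZ i)
  have hc : ∫⁻ ω, negExp (∑' i, w (Z i ω)) ∂P ≠ ∞ := by
    rw [h w hw]; exact negExp_ne_top _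
  have := lintegral_of_laplace (μ := P.withDensity fun ω => negExp (∑' i, w (Z i ω))) hG hc
    (M := ∫⁻ z in A, negExp (w z) ∂Λ) fun t ht => by
      rw [lintegral_withDensity_eq (by fun_prop) (by fun_prop)]
      have e1 : ∀ ω, negExp (∑' i, w (Z i ω)) * negExp (ENNReal.ofReal t *
          ∑' i, A.indicator (fun _ => (1 : ℝ≥0∞)) (Z i ω)) =
          negExp (∑' i, (w (Z i ω) + ENNReal.ofReal t * A.indicator (fun _ => 1) (Z i ω))) := by
        intro ω
        rw [ENNReal.tsum_add, ENNReal.tsum_mul_left, negExp_add]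
      simp only [e1]
      rw [h (fun z => w z + ENNReal.ofReal t * A.indicator (fun _ => 1) z) (by fun_prop), h w hw,
        ← negExp_add]
      congr 1
      rw [← lintegral_indicator hA, ← lintegral_const_mul _ (by
        exact (measurable_negExp.comp hw).indicator hA), ← lintegral_add_left (by fun_prop)]
      refine lintegral_congr fun z => ?_
      have e2 : ENNReal.ofReal (1 - Real.exp (-t)) = 1 - negExp (ENNReal.ofReal t) := by
        rw [negExp_ofReal ht, ENNReal.ofReal_sub _ (Real.exp_pos _).le, ENNReal.ofReal_one]
      -- On A, 1 - e^{-w-t} = (1 - e^{-w}) + (1 - e^{-t}) e^{-w}.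
      by_cases hz : z ∈ A
      · simp only [indicator_of_mem hz, mul_one, negExp_add, e2]
        rw [ENNReal.sub_mul (fun _ _ => negExp_ne_top _), one_mul,
          tsub_add_tsub_cancel (negExp_le_one _)
            (mul_le_of_le_one_left zero_le (negExp_le_one _)), mul_comm]
      · simp [indicator_of_notMem hz]
  rw [← this, lintegral_withDensity_eq (by fun_prop) hG]

/-- The Mecke formula for exponential functionals. -/
lemma tsum_lintegral_mul_negExp (h : HasPoissonLaplace P Z Λ) (hZ : ∀ i, Measurable (Z i))
    {w : E → ℝ≥0∞} (hw : Measurable w) {g : E → ℝ≥0∞} (hg : Measurable g) :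
    ∑' i, ∫⁻ ω, g (Z i ω) * negExp (∑' q, w (Z q ω)) ∂P =
      (∫⁻ ω, negExp (∑' i, w (Z i ω)) ∂P) * ∫⁻ z, g z * negExp (w z) ∂Λ := by
  have hW : Measurable fun ω => negExp (∑' i, w (Z i ω)) :=
    measurable_negExp.comp (Measurable.tsum fun i => hw.comp (hZ i))
  have hd : ∀ f : E → ℝ≥0∞, Measurable f → ∀ i,
      ∫⁻ z, f z ∂(P.withDensity fun ω => negExp (∑' i, w (Z i ω))).map (Z i) =
      ∫⁻ ω, f (Z i ω) * negExp (∑' q, w (Z q ω)) ∂P := by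
    intro f hf i
    rw [lintegral_map hf (hZ i), lintegral_withDensity_eq (g := fun ω => f (Z i ω)) hW (hf.comp (hZ i))]
    exact lintegral_congr fun ω => mul_comm _ _
  -- The indicator case is an identity of measures on `E`; integrating g against both sides gives
  -- the general case.
  have hm : (Measure.sum fun i => (P.withDensity fun ω => negExp (∑' i, w (Z i ω))).map (Z i)) =
      (∫⁻ ω, negExp (∑' i, w (Z i ω)) ∂P) • Λ.withDensity fun z => negExp (w z) := by
    ext A hA
    rw [Measure.sum_apply _ hA, Measure.smul_apply, withDensity_apply _ hA, smul_eq_mul,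
      ← h.lintegral_negExp_mul_count hZ hw hA]
    have hA' : Measurable (A.indicator (fun _ => (1 : ℝ≥0∞))) := measurable_const.indicator hA
    have e : ∀ i, (P.withDensity fun ω => negExp (∑' i, w (Z i ω))).map (Z i) A =
        ∫⁻ ω, A.indicator (fun _ => 1) (Z i ω) * negExp (∑' q, w (Z q ω)) ∂P := fun i => by
      rw [← hd _ hA' i, lintegral_indicator hA]; simp
    simp_rw [e]
    rw [← lintegral_tsum (f := fun i ω => A.indicator (fun _ => 1) (Z i ω) *
      negExp (∑' q, w (Z q ω))) fun i => ((hA'.comp (hZ i)).mul hW).aemeasurable]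
    refine lintegral_congr fun ω => ?_
    rw [ENNReal.tsum_mul_right, mul_comm]
  have := congrArg (fun m => ∫⁻ z, g z ∂m) hm
  simp only [lintegral_sum_measure, lintegral_smul_measure, hd g hg, smul_eq_mul] at this
  rw [this, lintegral_withDensity_eq (by fun_prop) hg]
  congr 1
  exact lintegral_congr fun z => mul_comm _ _

/-- The reduced Mecke formula for exponential functionals. -/
lemma tsum_lintegral_mul_negExp_ne [DecidableEq ι] (h : HasPoissonLaplace P Z Λ) (hZ : ∀ i, Measurable (Z i))
    {w : E → ℝ≥0∞} (hw : Measurable w) {g : E → ℝ≥0∞} (hg : Measurable g)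
    (hgw : ∀ z, g z ≠ 0 → w z ≠ ∞) :
    ∑' i, ∫⁻ ω, g (Z i ω) * negExp (∑' q, if q = i then 0 else w (Z q ω)) ∂P =
      (∫⁻ ω, negExp (∑' i, w (Z i ω)) ∂P) * ∫⁻ z, g z ∂Λ := by
  -- The omitted term q = i would contribute a factor e^{-w(Z_i)}, nonzero where g is; applying the
  -- full formula to g / e^{-w} cancels it.
  have key : ∀ z, g z / negExp (w z) * negExp (w z) = g z := fun z => by
    by_cases hz : g z = 0
    · simp [hz]
    · exact ENNReal.div_mul_cancel (fun e => hgw z hz (negExp_eq_zero_iff.1 e)) (negExp_ne_top _)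
  have := h.tsum_lintegral_mul_negExp hZ hw (g := fun z => g z / negExp (w z)) (by fun_prop)
  simp only [key] at this
  rw [← this]
  refine tsum_congr fun i => lintegral_congr fun ω => ?_
  rw [tsum_eq_add_tsum_ne (fun q => w (Z q ω)) i, negExp_add, ← mul_assoc, key]

/-- Campbell's formula. -/
lemma tsum_lintegral [IsProbabilityMeasure P] (h : HasPoissonLaplace P Z Λ) (hZ : ∀ i, Measurable (Z i))
    {g : E → ℝ≥0∞} (hg : Measurable g) :
    ∑' i, ∫⁻ ω, g (Z i ω) ∂P = ∫⁻ z, g z ∂Λ := by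
  simpa using h.tsum_lintegral_mul_negExp hZ (w := fun _ => 0) measurable_const hg

/-- The reduced Mecke formula with g = 1_A and w = t·1_B, differentiated at t = 0, gives the
expected number of ordered pairs of points with distinct indices in A × B. -/
lemma tsum_measure_pair [DecidableEq ι] (h : HasPoissonLaplace P Z Λ) (hZ : ∀ i, Measurable (Z i))
    {A B : Set E} (hA : MeasurableSet A) (hB : MeasurableSet B) (hΛ : Λ A ≠ ∞) :
    ∑' i, ∫⁻ ω, A.indicator (fun _ => 1) (Z i ω) *
      (∑' q, if q = i then 0 else B.indicator (fun _ => 1) (Z q ω)) ∂P = Λ A * Λ B := by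
  let _ : MeasurableSpace ι := ⊤
  have hA' : Measurable (A.indicator (fun _ => (1 : ℝ≥0∞))) := measurable_const.indicator hA
  have hB' : Measurable (B.indicator (fun _ => (1 : ℝ≥0∞))) := measurable_const.indicator hB
  -- On index-outcome pairs weighted by 1_A(Z_i) the sum over i is a single integral, so
  -- `lintegral_of_laplace` applies with total mass Λ A; this is where finiteness of Λ A enters.
  set μ : Measure (ι × Ω) := Measure.sum fun i =>
    (P.withDensity fun ω => A.indicator (fun _ => (1 : ℝ≥0∞)) (Z i ω)).map (Prod.mk i)
  set G : ι × Ω → ℝ≥0∞ := fun a =>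
    ∑' q, if q = a.1 then 0 else B.indicator (fun _ => (1 : ℝ≥0∞)) (Z q a.2) with hGdef
  have hG : Measurable G := measurable_from_prod_countable_right fun i => by
    refine Measurable.tsum fun q => ?_
    by_cases hq : q = i
    · simp [hq]
    · simp only [hq, if_false]
      exact hB'.comp (hZ q)
  have hμ : ∀ f : ι × Ω → ℝ≥0∞, Measurable f →
      ∫⁻ a, f a ∂μ = ∑' i, ∫⁻ ω, A.indicator (fun _ => (1 : ℝ≥0∞)) (Z i ω) * f (i, ω) ∂P := by
    intro f hf
    rw [lintegral_sum_measure]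
    refine tsum_congr fun i => ?_
    rw [lintegral_map hf measurable_prodMk_left]
    exact lintegral_withDensity_eq (hA'.comp (hZ i)) (hf.comp measurable_prodMk_left)
  rw [← lintegral_of_laplace (μ := μ) hG hΛ (M := Λ B), hμ G hG]
  intro t ht
  rw [hμ _ (by fun_prop)]
  have e1 : ∀ i ω, ENNReal.ofReal t * G (i, ω) = ∑' q, if q = i then 0 else
      (fun z => ENNReal.ofReal t * B.indicator (fun _ => 1) z) (Z q ω) := fun i ω => by
    rw [hGdef, ← ENNReal.tsum_mul_left]
    exact tsum_congr fun q => by simp only [mul_ite, mul_zero]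
  simp_rw [e1]
  have hB'' : Measurable fun z => ENNReal.ofReal t * B.indicator (fun _ => (1 : ℝ≥0∞)) z := by
    fun_prop
  refine (h.tsum_lintegral_mul_negExp_ne hZ hB'' hA' ?_).trans ?_
  · intro z _
    exact ENNReal.mul_ne_top ENNReal.ofReal_ne_top
      (ne_top_of_le_ne_top ENNReal.one_ne_top (indicator_le_self' (by simp) z))
  · rw [h _ hB'', lintegral_indicator hA, mul_comm]
    congr 1
    · simp
    · have e2 : ∀ z, 1 - negExp (ENNReal.ofReal t * B.indicator (fun _ => 1) z) =
          ENNReal.ofReal (1 - Real.exp (-t)) * B.indicator (fun _ => 1) z := fun z => by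
        by_cases hz : z ∈ B
        · simp [hz, negExp_ofReal ht, ENNReal.ofReal_sub _ (Real.exp_pos _).le]
        · simp [hz]
      simp_rw [e2]
      rw [lintegral_const_mul _ hB', lintegral_indicator hB]
      simp

/-- Two distinct points of a Poisson process are almost surely not in a relation that is null for
the product of the intensity measures. -/
lemma ae_pair_notMem [SigmaFinite Λ] (h : HasPoissonLaplace P Z Λ) (hZ : ∀ i, Measurable (Z i))
    {D : Set (E × E)} (hD : MeasurableSet D) (h0 : Λ.prod Λ D = 0) :
    ∀ᵐ ω ∂P, ∀ i q, q ≠ i → (Z i ω, Z q ω) ∉ D := by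
  classical
  -- The second factorial moment measure. It agrees with Λ ⊗ Λ on rectangles whose first side has
  -- finite measure, hence everywhere.
  set ν : Measure (E × E) := Measure.sum fun i => Measure.sum fun q =>
    if q = i then 0 else P.map fun ω => (Z i ω, Z q ω)
  have hZZ : ∀ i q, Measurable fun ω => (Z i ω, Z q ω) := fun i q => (hZ i).prodMk (hZ q)
  have hrect : ∀ A B : Set E, MeasurableSet A → MeasurableSet B → Λ A ≠ ∞ →
      ν (A ×ˢ B) = Λ A * Λ B := by
    intro A B hA hB hΛ
    have hA' : Measurable (A.indicator (fun _ => (1 : ℝ≥0∞))) := measurable_const.indicator hA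
    have hB' : Measurable (B.indicator (fun _ => (1 : ℝ≥0∞))) := measurable_const.indicator hB
    rw [← h.tsum_measure_pair hZ hA hB hΛ, Measure.sum_apply _ (hA.prod hB)]
    refine tsum_congr fun i => ?_
    rw [Measure.sum_apply _ (hA.prod hB)]
    simp_rw [← ENNReal.tsum_mul_left]
    rw [lintegral_tsum fun q => ?_]
    · refine tsum_congr fun q => ?_
      by_cases hq : q = i
      · simp [hq]
      · simp only [hq, if_false]
        rw [← setLIntegral_one, ← lintegral_indicator (hA.prod hB),
          lintegral_map (measurable_const.indicator (hA.prod hB)) (hZZ i q)]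
        refine lintegral_congr fun ω => ?_
        by_cases h1 : Z i ω ∈ A <;> by_cases h2 : Z q ω ∈ B <;> simp [h1, h2]
    · by_cases hq : q = i
      · simp [hq]
      · simp only [hq, if_false]
        exact ((hA'.comp (hZ i)).mul (hB'.comp (hZ q))).aemeasurable
  have hν : Λ.prod Λ = ν := by
    have hgen : MeasurableSpace.generateFrom {A | MeasurableSet A ∧ Λ A ≠ ∞} = ‹_› := by
      refine le_antisymm (MeasurableSpace.generateFrom_le fun A hA => hA.1) fun A hA => ?_
      rw [← inter_univ A, ← iUnion_spanningSets Λ, inter_iUnion]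
      refine MeasurableSet.iUnion fun n => MeasurableSpace.measurableSet_generateFrom ?_
      exact ⟨hA.inter (measurableSet_spanningSets Λ n), ne_top_of_le_ne_top
        (measure_spanningSets_lt_top Λ n).ne (measure_mono inter_subset_right)⟩
    refine Measure.prod_eq_generateFrom hgen MeasurableSpace.generateFrom_measurableSet ?_
      MeasurableSpace.isPiSystem_measurableSet
      (Λ.toFiniteSpanningSetsIn.mono' fun A hA => ⟨hA.1, hA.2.ne⟩) Λ.toFiniteSpanningSetsIn
      fun A hA B hB => hrect A B hA.1 hB hA.2
    exact fun A hA B hB _ => ⟨hA.1.inter hB.1,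
      ne_top_of_le_ne_top hA.2 (measure_mono inter_subset_left)⟩
  have hνD : ν D = 0 := hν ▸ h0
  rw [Measure.sum_apply _ hD, ENNReal.tsum_eq_zero] at hνD
  rw [ae_all_iff]
  intro i
  rw [ae_all_iff]
  intro q
  have h1 := hνD i
  rw [Measure.sum_apply _ hD, ENNReal.tsum_eq_zero] at h1
  have h2 := h1 q
  by_cases hq : q = i
  · exact Eventually.of_forall fun ω hne => absurd hq hne
  · rw [if_neg hq, Measure.map_apply (hZZ i q) hD] at h2
    filter_upwards [measure_eq_zero_iff_ae_notMem.1 h2] with ω hω _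
    exact hω

end HasPoissonLaplace

/-! ### The Mecke formula with a parameter depending on the point -/

/-- Fatou gives the lower bound and the termwise inequality the upper one, so the limiting sum may
be infinite, unlike under domination by a summable sequence. -/
lemma tendsto_tsum_of_le {ι : Type*} [Countable ι] {f : ℕ → ι → ℝ≥0∞} {g : ι → ℝ≥0∞}
    (hle : ∀ᶠ j in atTop, ∀ i, f j i ≤ g i) (hlim : ∀ i, Tendsto (fun j => f j i) atTop (𝓝 (g i))) :
    Tendsto (fun j => ∑' i, f j i) atTop (𝓝 (∑' i, g i)) := by
  let _ : MeasurableSpace ι := ⊤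
  refine tendsto_of_le_liminf_of_limsup_le ?_ ?_
  · simp_rw [← lintegral_count]
    calc ∫⁻ i, g i ∂Measure.count = ∫⁻ i, liminf (fun j => f j i) atTop ∂Measure.count :=
          lintegral_congr fun i => (hlim i).liminf_eq.symm
      _ ≤ _ := lintegral_liminf_le fun j => measurable_of_countable _
  · refine limsup_le_of_le (by isBoundedDefault) ?_
    filter_upwards [hle] with j hj using ENNReal.tsum_le_tsum hj

lemma tendsto_tsum_of_dominated {ι : Type*} [Countable ι] {f : ℕ → ι → ℝ≥0∞} {g b : ι → ℝ≥0∞}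
    (hb : ∑' i, b i ≠ ∞) (hle : ∀ j i, f j i ≤ b i)
    (hlim : ∀ i, Tendsto (fun j => f j i) atTop (𝓝 (g i))) :
    Tendsto (fun j => ∑' i, f j i) atTop (𝓝 (∑' i, g i)) := by
  let _ : MeasurableSpace ι := ⊤
  simp_rw [← lintegral_count] at hb ⊢
  exact tendsto_lintegral_of_dominated_convergence b (fun j => measurable_of_countable _)
    (fun j => Eventually.of_forall (hle j)) hb (Eventually.of_forall hlim)

/-- The largest multiple of `1 / (j + 1)` that is less than `x`. -/
noncomputable def gridBelow (j : ℕ) (x : ℝ) : ℝ := ((⌈x * (j + 1)⌉₊ - 1 : ℕ) : ℝ) / (j + 1)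

lemma gridBelow_lt {j : ℕ} {x : ℝ} (hx : 0 < x) : gridBelow j x < x := by
  have h : 0 < x * (j + 1) := by positivity
  have h1 : 0 < ⌈x * (j + 1)⌉₊ := Nat.ceil_pos.2 h
  rw [gridBelow, div_lt_iff₀ (by positivity), Nat.cast_sub h1]
  have := Nat.ceil_lt_add_one h.le
  push_cast; linarith

lemma le_gridBelow {j : ℕ} {x : ℝ} : x - 1 / (j + 1) ≤ gridBelow j x := by
  rw [gridBelow, le_div_iff₀ (by positivity), sub_mul, div_mul_cancel₀ _ (by positivity)]
  have h1 := Nat.le_ceil (x * (j + 1))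
  have h2 : ((⌈x * (j + 1)⌉₊ : ℕ) : ℝ) ≤ ((⌈x * (j + 1)⌉₊ - 1 : ℕ) : ℝ) + 1 := by
    have : ⌈x * (j + 1)⌉₊ ≤ ⌈x * (j + 1)⌉₊ - 1 + 1 := by omega
    exact_mod_cast this
  linarith

lemma tendsto_gridBelow {x : ℝ} (hx : 0 < x) :
    Tendsto (fun j => gridBelow j x) atTop (𝓝[<] x) := by
  rw [tendsto_nhdsWithin_iff]
  refine ⟨?_, Eventually.of_forall fun j => gridBelow_lt hx⟩
  refine tendsto_of_tendsto_of_tendsto_of_le_of_le ?_ tendsto_const_nhds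
    (fun j => le_gridBelow) (fun j => (gridBelow_lt hx).le)
  simpa using (tendsto_one_div_add_atTop_nhds_zero_nat (𝕜 := ℝ)).const_sub x

namespace HasPoissonLaplace

variable {Ω E ι : Type*} [MeasurableSpace Ω] [MeasurableSpace E] [Countable ι] {P : Measure Ω}
  {Z : ι → Ω → E} {Λ : Measure E} [DecidableEq ι]

/-- The reduced Mecke formula on a grid of parameters. -/
lemma tsum_lintegral_mul_negExp_grid (h : HasPoissonLaplace P Z Λ) (hZ : ∀ i, Measurable (Z i))
    {w : ℝ → E → ℝ≥0∞} (hw : Measurable (Function.uncurry w)) {R : E → ℝ} (hR : Measurable R)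
    {g : E → ℝ≥0∞} (hg : Measurable g) (hgR : ∀ z, g z ≠ 0 → 0 < R z)
    (hgw : ∀ z, g z ≠ 0 → ∀ r, 0 < r → r ≤ R z → w r z ≠ ∞) (j : ℕ) :
    ∑' i, ∫⁻ ω, (if 0 < gridBelow j (R (Z i ω)) then g (Z i ω) else 0) *
        negExp (∑' q, if q = i then 0 else w (gridBelow j (R (Z i ω))) (Z q ω)) ∂P =
      ∫⁻ z, (if 0 < gridBelow j (R z) then g z else 0) *
        ∫⁻ ω, negExp (∑' q, w (gridBelow j (R z)) (Z q ω)) ∂P ∂Λ := by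
  set a : ℕ → ℝ := fun n => (n : ℝ) / (j + 1)
  set idx : E → ℕ := fun z => ⌈R z * (j + 1)⌉₊ - 1
  have hidx : Measurable idx :=
    (measurable_of_countable fun n : ℕ => n - 1).comp (Nat.measurable_ceil.comp (hR.mul_const _))
  have hgrid : ∀ z, gridBelow j (R z) = a (idx z) := fun z => rfl
  -- On the cell `idx z = n` the parameter is the constant `a n`, so the formula with a fixed test
  -- function applies. The cell with parameter 0 is dropped, since w is controlled only at positive
  -- parameters.
  set G : ℕ → E → ℝ≥0∞ := fun n z => if idx z = n then (if 0 < a n then g z else 0) else 0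
  have hG : ∀ n, Measurable (G n) := fun n => by
    refine Measurable.ite (hidx (measurableSet_singleton n)) ?_ measurable_const
    split_ifs
    · exact hg
    · exact measurable_const
  have hGsum : ∀ (z : E) (F : ℝ → ℝ≥0∞), ∑' n, G n z * F (a n) =
      (if 0 < gridBelow j (R z) then g z else 0) * F (gridBelow j (R z)) := by
    intro z F
    rw [tsum_eq_single (idx z)]
    · simp [G, hgrid]
    · intro n hn
      simp [G, hn.symm]
  have hwr : ∀ r, Measurable (w r) := fun r => hw.comp measurable_prodMk_left
  have key : ∀ n, ∑' i, ∫⁻ ω, G n (Z i ω) *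
      negExp (∑' q, if q = i then 0 else w (a n) (Z q ω)) ∂P =
      ∫⁻ z, G n z * ∫⁻ ω, negExp (∑' q, w (a n) (Z q ω)) ∂P ∂Λ := fun n => by
    rw [h.tsum_lintegral_mul_negExp_ne hZ (hwr (a n)) (hG n), lintegral_mul_const _ (hG n), mul_comm]
    intro z hz
    have h1 : idx z = n := by by_contra hne; simp [G, hne] at hz
    have h2 : 0 < a n := by by_contra hne; simp [G, hne] at hz
    have h3 : g z ≠ 0 := by intro e; simp [G, e] at hz
    -- Rounding below R z is what keeps w finite at the distinguished point, as the reduced formula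
    -- needs.
    refine hgw z h3 _ h2 ?_
    rw [← h1, ← hgrid]
    exact (gridBelow_lt (hgR z h3)).le
  have hsum := tsum_congr (L := .unconditional ℕ) key
  rw [ENNReal.tsum_comm] at hsum
  have hL : ∀ i n, Measurable fun ω => G n (Z i ω) *
      negExp (∑' q, if q = i then 0 else w (a n) (Z q ω)) := fun i n => by
    refine ((hG n).comp (hZ i)).mul (measurable_negExp.comp (Measurable.tsum fun q => ?_))
    by_cases hq : q = i
    · simp [hq]
    · simp only [hq, if_false]; exact (hwr _).comp (hZ q)
  simp_rw [← lintegral_tsum fun n => (hL _ n).aemeasurable] at hsum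
  rw [← lintegral_tsum fun n => ((hG n).mul_const _).aemeasurable] at hsum
  calc _ = _ := tsum_congr fun i => lintegral_congr fun ω =>
        (hGsum (Z i ω) fun r => negExp (∑' q, if q = i then 0 else w r (Z q ω))).symm
    _ = _ := hsum
    _ = _ := lintegral_congr fun z =>
        hGsum z fun r => ∫⁻ ω, negExp (∑' q, w r (Z q ω)) ∂P

/-- The grid is refined from below. Monotonicity and left continuity of w in the parameter give
convergence of the inner sums, and Campbell's formula makes g(Z_i) a summable dominating family. -/
lemma tsum_lintegral_mul_negExp_param_of_finite [IsProbabilityMeasure P]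
    (h : HasPoissonLaplace P Z Λ)
    (hZ : ∀ i, Measurable (Z i))
    {w : ℝ → E → ℝ≥0∞} (hw : Measurable (Function.uncurry w)) {R : E → ℝ} (hR : Measurable R)
    {g : E → ℝ≥0∞} (hg : Measurable g) (hgR : ∀ z, g z ≠ 0 → 0 < R z)
    (hgw : ∀ z, g z ≠ 0 → ∀ r, 0 < r → r ≤ R z → w r z ≠ ∞)
    (hmono : ∀ z r r', 0 < r → r ≤ r' → w r z ≤ w r' z)
    (hlim : ∀ z r, 0 < r → Tendsto (fun s => w s z) (𝓝[<] r) (𝓝 (w r z)))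
    (hg1 : ∀ z, g z ≤ 1) (hfin : ∫⁻ z, g z ∂Λ ≠ ∞) :
    ∑' i, ∫⁻ ω, g (Z i ω) *
        negExp (∑' q, if q = i then 0 else w (R (Z i ω)) (Z q ω)) ∂P =
      ∫⁻ z, g z * ∫⁻ ω, negExp (∑' q, w (R z) (Z q ω)) ∂P ∂Λ := by
  have hgridm : ∀ j, Measurable (gridBelow j) := fun j =>
    ((measurable_of_countable fun n : ℕ => (((n - 1 : ℕ) : ℝ) / (j + 1))).comp
      (Nat.measurable_ceil.comp (measurable_id.mul_const _)))
  have hcamp := h.tsum_lintegral hZ hg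
  have hpos : ∀ x : ℝ, 0 < x → ∀ᶠ j in atTop, 0 < gridBelow j x := fun x hx =>
    ((tendsto_gridBelow hx).mono_right nhdsWithin_le_nhds).eventually (lt_mem_nhds hx)
  -- pointwise limits of the sums
  have hV : ∀ (v : ι → ℝ → ℝ≥0∞) (x : ℝ), 0 < x → (∀ q, ∀ r r', 0 < r → r ≤ r' → v q r ≤ v q r') →
      (∀ q, Tendsto (v q) (𝓝[<] x) (𝓝 (v q x))) →
      Tendsto (fun j => negExp (∑' q, v q (gridBelow j x))) atTop (𝓝 (negExp (∑' q, v q x))) := by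
    intro v x hx hm hl
    refine (continuous_negExp.tendsto _).comp (tendsto_tsum_of_le ?_ fun q =>
      (hl q).comp (tendsto_gridBelow hx))
    filter_upwards [hpos x hx] with j hj q
    exact hm q _ _ hj (gridBelow_lt hx).le
  have hgj : ∀ (z : E) (F : ℕ → ℝ≥0∞) (L : ℝ≥0∞), (∀ j, F j ≤ 1) →
      (0 < R z → Tendsto F atTop (𝓝 L)) →
      Tendsto (fun j => (if 0 < gridBelow j (R z) then g z else 0) * F j) atTop (𝓝 (g z * L)) := by
    intro z F L hF hFL
    by_cases hz : g z = 0
    · simp [hz]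
    · have hx := hgR z hz
      have hzt : g z ≠ ∞ := ne_top_of_le_ne_top ENNReal.one_ne_top (hg1 z)
      refine (ENNReal.Tendsto.const_mul (hFL hx) (Or.inr hzt)).congr' ?_
      filter_upwards [hpos _ hx] with j hj
      rw [if_pos hj]
  have hle : ∀ j z (y : ℝ≥0∞), y ≤ 1 →
      (if 0 < gridBelow j (R z) then g z else 0) * y ≤ g z := by
    intro j z y hy
    refine (mul_le_of_le_one_right zero_le hy).trans ?_
    split_ifs
    · exact le_rfl
    · exact zero_le
  have hVmeas : ∀ (i : ι) (ρ : ℝ → ℝ), Measurable ρ → Measurable fun ω =>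
      negExp (∑' q, if q = i then 0 else w (ρ (R (Z i ω))) (Z q ω)) := fun i ρ hρ => by
    refine measurable_negExp.comp (Measurable.tsum fun q => ?_)
    by_cases hq : q = i
    · simp [hq]
    · simp only [hq, if_false]
      exact hw.comp ((hρ.comp (hR.comp (hZ i))).prodMk (hZ q))
  have hQmeas : ∀ ρ : ℝ → ℝ, Measurable ρ → Measurable fun z =>
      ∫⁻ ω, negExp (∑' q, w (ρ (R z)) (Z q ω)) ∂P := fun ρ hρ => by
    refine Measurable.lintegral_prod_right'
      (f := fun a : E × Ω => negExp (∑' q, w (ρ (R a.1)) (Z q a.2))) ?_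
    refine measurable_negExp.comp (Measurable.tsum fun q => ?_)
    exact hw.comp ((hρ.comp (hR.comp measurable_fst)).prodMk ((hZ q).comp measurable_snd))
  have hgjm : ∀ j, Measurable fun z => if 0 < gridBelow j (R z) then g z else 0 := fun j =>
    Measurable.ite (measurableSet_lt measurable_const ((hgridm j).comp hR)) hg measurable_const
  have hQ1 : ∀ r, ∫⁻ ω, negExp (∑' q, w r (Z q ω)) ∂P ≤ 1 := fun r => by
    calc _ ≤ ∫⁻ _, 1 ∂P := lintegral_mono fun ω => negExp_le_one _
      _ = 1 := by simp
  have hLlim : Tendsto (fun j => ∑' i, ∫⁻ ω, (if 0 < gridBelow j (R (Z i ω)) then g (Z i ω) else 0) *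
        negExp (∑' q, if q = i then 0 else w (gridBelow j (R (Z i ω))) (Z q ω)) ∂P) atTop
      (𝓝 (∑' i, ∫⁻ ω, g (Z i ω) *
        negExp (∑' q, if q = i then 0 else w (R (Z i ω)) (Z q ω)) ∂P)) := by
    refine tendsto_tsum_of_dominated (b := fun i => ∫⁻ ω, g (Z i ω) ∂P) (hcamp ▸ hfin)
      (fun j i => lintegral_mono fun ω => hle _ _ _ (negExp_le_one _)) fun i => ?_
    · refine tendsto_lintegral_of_dominated_convergence (fun ω => g (Z i ω))
        (fun j => ((hgjm j).comp (hZ i)).mul (hVmeas i _ (hgridm j)))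
        (fun j => Eventually.of_forall fun ω => hle _ _ _ (negExp_le_one _)) ?_
        (Eventually.of_forall fun ω => ?_)
      · exact ne_top_of_le_ne_top (hcamp ▸ hfin)
          (ENNReal.le_tsum (f := fun i => ∫⁻ ω, g (Z i ω) ∂P) i)
      · refine hgj _ _ _ (fun j => negExp_le_one _) fun hx => ?_
        refine hV (fun q r => if q = i then 0 else w r (Z q ω)) _ hx (fun q r r' h0 hr => ?_)
          fun q => ?_
        · split_ifs
          · exact le_rfl
          · exact hmono _ _ _ h0 hr
        · by_cases hq : q = i
          · simp [hq]
          · simpa only [hq, if_false] using hlim _ _ hx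
  have hRlim : Tendsto (fun j => ∫⁻ z, (if 0 < gridBelow j (R z) then g z else 0) *
        ∫⁻ ω, negExp (∑' q, w (gridBelow j (R z)) (Z q ω)) ∂P ∂Λ) atTop
      (𝓝 (∫⁻ z, g z * ∫⁻ ω, negExp (∑' q, w (R z) (Z q ω)) ∂P ∂Λ)) := by
    refine tendsto_lintegral_of_dominated_convergence g
      (fun j => (hgjm j).mul (hQmeas _ (hgridm j)))
      (fun j => Eventually.of_forall fun z => hle _ _ _ (hQ1 _)) hfin
      (Eventually.of_forall fun z => ?_)
    refine hgj _ _ _ (fun j => hQ1 _) fun hx => ?_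
    refine tendsto_lintegral_of_dominated_convergence (fun _ => 1)
      (fun j => measurable_negExp.comp (Measurable.tsum fun q =>
        hw.comp (measurable_const.prodMk (hZ q))))
      (fun j => Eventually.of_forall fun ω => negExp_le_one _) (by simp)
      (Eventually.of_forall fun ω => ?_)
    exact hV (fun q r => w r (Z q ω)) _ hx (fun q r r' h0 hr => hmono _ _ _ h0 hr)
      fun q => hlim _ _ hx
  simp_rw [h.tsum_lintegral_mul_negExp_grid hZ hw hR hg hgR hgw] at hLlim
  exact tendsto_nhds_unique hLlim hRlim

/-- The reduced Mecke formula for exponential functionals that depend on the point through a real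
parameter. -/
lemma tsum_lintegral_mul_negExp_param [IsProbabilityMeasure P] [SigmaFinite Λ]
    (h : HasPoissonLaplace P Z Λ)
    (hZ : ∀ i, Measurable (Z i))
    {w : ℝ → E → ℝ≥0∞} (hw : Measurable (Function.uncurry w)) {R : E → ℝ} (hR : Measurable R)
    {g : E → ℝ≥0∞} (hg : Measurable g) (hg1 : ∀ z, g z ≤ 1) (hgR : ∀ z, g z ≠ 0 → 0 < R z)
    (hgw : ∀ z, g z ≠ 0 → ∀ r, 0 < r → r ≤ R z → w r z ≠ ∞)
    (hmono : ∀ z r r', 0 < r → r ≤ r' → w r z ≤ w r' z)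
    (hlim : ∀ z r, 0 < r → Tendsto (fun s => w s z) (𝓝[<] r) (𝓝 (w r z))) :
    ∑' i, ∫⁻ ω, g (Z i ω) *
        negExp (∑' q, if q = i then 0 else w (R (Z i ω)) (Z q ω)) ∂P =
      ∫⁻ z, g z * ∫⁻ ω, negExp (∑' q, w (R z) (Z q ω)) ∂P ∂Λ := by
  -- Cutting g along disjoint pieces of finite intensity reduces to integrable g, because g ≤ 1.
  set D : ℕ → Set E := disjointed (spanningSets Λ)
  have hD : ∀ n, MeasurableSet (D n) :=
    MeasurableSet.disjointed (measurableSet_spanningSets Λ)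
  have hDsum : ∀ z, ∑' n, (D n).indicator g z = g z := fun z => by
    have hz : z ∈ ⋃ n, D n := by rw [iUnion_disjointed, iUnion_spanningSets]; trivial
    obtain ⟨n, hn⟩ := mem_iUnion.1 hz
    rw [tsum_eq_single n, indicator_of_mem hn]
    intro m hm
    refine indicator_of_notMem (fun hmz => ?_) _
    exact disjoint_left.1 (disjoint_disjointed (spanningSets Λ) hm) hmz hn
  have hgn : ∀ n, Measurable ((D n).indicator g) := fun n => hg.indicator (hD n)
  have hne : ∀ n z, (D n).indicator g z ≠ 0 → g z ≠ 0 := fun n z hz e => hz (by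
    by_cases hzD : z ∈ D n <;> simp [hzD, e])
  have key := fun n => h.tsum_lintegral_mul_negExp_param_of_finite hZ hw hR (hgn n)
    (fun z hz => hgR z (hne n z hz)) (fun z hz => hgw z (hne n z hz)) hmono hlim
    (fun z => (indicator_le_self' (fun _ _ => zero_le) z).trans (hg1 z)) (by
      rw [lintegral_indicator (hD n)]
      refine ne_top_of_le_ne_top (measure_spanningSets_lt_top Λ n).ne ?_
      calc ∫⁻ z in D n, g z ∂Λ ≤ ∫⁻ z in D n, 1 ∂Λ := lintegral_mono fun z => hg1 z
        _ = Λ (D n) := by simp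
        _ ≤ _ := measure_mono (disjointed_subset _ n))
  have hsum := tsum_congr (L := .unconditional ℕ) key
  rw [ENNReal.tsum_comm] at hsum
  have hVmeas : ∀ i, Measurable fun ω =>
      negExp (∑' q, if q = i then 0 else w (R (Z i ω)) (Z q ω)) := fun i => by
    refine measurable_negExp.comp (Measurable.tsum fun q => ?_)
    by_cases hq : q = i
    · simp [hq]
    · simp only [hq, if_false]
      exact hw.comp ((hR.comp (hZ i)).prodMk (hZ q))
  have hQmeas : Measurable fun z => ∫⁻ ω, negExp (∑' q, w (R z) (Z q ω)) ∂P := by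
    refine Measurable.lintegral_prod_right'
      (f := fun a : E × Ω => negExp (∑' q, w (R a.1) (Z q a.2))) ?_
    refine measurable_negExp.comp (Measurable.tsum fun q => ?_)
    exact hw.comp ((hR.comp measurable_fst).prodMk ((hZ q).comp measurable_snd))
  have hL : ∀ i n, Measurable fun ω => (D n).indicator g (Z i ω) *
      negExp (∑' q, if q = i then 0 else w (R (Z i ω)) (Z q ω)) := fun i n =>
    ((hgn n).comp (hZ i)).mul (hVmeas i)
  simp_rw [← lintegral_tsum fun n => (hL _ n).aemeasurable] at hsum
  have hRm : ∀ n, Measurable fun z => (D n).indicator g z *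
      ∫⁻ ω, negExp (∑' q, w (R z) (Z q ω)) ∂P := fun n => (hgn n).mul hQmeas
  rw [← lintegral_tsum fun n => (hRm n).aemeasurable] at hsum
  calc _ = _ := tsum_congr fun i => lintegral_congr fun ω => by
        conv_lhs => rw [← hDsum (Z i ω), ← ENNReal.tsum_mul_right]
    _ = _ := hsum
    _ = _ := lintegral_congr fun z => by
        conv_rhs => rw [← hDsum z, ← ENNReal.tsum_mul_right]

end HasPoissonLaplace

/-! ### Polar coordinates and the intensity of the marked base stations -/

/-- Polar coordinates in the plane for radial functions. -/
lemma lintegral_fun_norm_plane {f : ℝ → ℝ≥0∞} (hf : Measurable f) :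
    ∫⁻ x : Plane, f ‖x‖ = ∫⁻ r in Ioi (0 : ℝ), ENNReal.ofReal (2 * Real.pi * r) * f r := by
  have hd : Module.finrank ℝ Plane = 2 := by simp
  have hS : (volume : Measure Plane).toSphere univ = ENNReal.ofReal (2 * Real.pi) := by
    rw [Measure.toSphere_apply_univ, hd, EuclideanSpace.volume_ball_fin_two]
    rw [ENNReal.ofReal_mul (by norm_num)]
    simp
  calc ∫⁻ x : Plane, f ‖x‖
      = ∫⁻ x : ({(0)}ᶜ : Set Plane), f ‖x.1‖ ∂((volume : Measure Plane).comap (↑)) := by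
        rw [lintegral_subtype_comap (measurableSet_singleton _).compl fun x : Plane => f ‖x‖,
          restrict_compl_singleton]
    _ = ∫⁻ x, f x.2 ∂(volume : Measure Plane).toSphere.prod
          (.volumeIoiPow (Module.finrank ℝ Plane - 1)) := by
        rw [← (volume : Measure Plane).measurePreserving_homeomorphUnitSphereProd.lintegral_comp_emb
          (Homeomorph.measurableEmbedding _) (fun x => f x.2)]
        simp
    _ = ENNReal.ofReal (2 * Real.pi) *
          ∫⁻ x, f x ∂(Measure.volumeIoiPow (Module.finrank ℝ Plane - 1)) := by
        rw [lintegral_prod _ (by fun_prop)]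
        simp only [lintegral_const]
        rw [hS, mul_comm]
    _ = _ := by
        rw [hd, Measure.volumeIoiPow, lintegral_withDensity_eq (by fun_prop) (by fun_prop),
          lintegral_subtype_comap measurableSet_Ioi
            (fun r : ℝ => ENNReal.ofReal (r ^ (2 - 1)) * f r),
          ← lintegral_const_mul _ (by fun_prop)]
        refine lintegral_congr fun r => ?_
        rw [← mul_assoc, ← ENNReal.ofReal_mul (by positivity)]
        simp

instance : MeasurableSpace Tier := ⊤
instance : MeasurableSpace Link := ⊤
instance : DiscreteMeasurableSpace Tier := ⟨fun _ => trivial⟩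
instance : DiscreteMeasurableSpace Link := ⟨fun _ => trivial⟩

/-- A base station: its tier and location, its blockage variable and its fading power. -/
abbrev Station : Type := (Tier × Plane) × (ℝ × ℝ)

namespace Params

variable (p : Params)

lemma measurable_losProb : Measurable p.losProb := by
  unfold losProb; fun_prop

lemma losProb_mem (r : ℝ) (hr : 0 ≤ r) : p.losProb r ∈ Icc (0 : ℝ) 1 := by
  have h1 : 0 ≤ min (18 / r) 1 := le_min (by positivity) zero_le_one
  have h2 : min (18 / r) 1 ≤ 1 := min_le_right _ _
  have h3 : Real.exp (-p.β * r) ≤ 1 := by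
    rw [Real.exp_le_one_iff]; nlinarith [p.β_nonneg]
  have h4 := Real.exp_pos (-p.β * r)
  unfold losProb
  constructor <;> nlinarith

lemma linkProb_mem (ν : Link) (r : ℝ) (hr : 0 ≤ r) : p.linkProb ν r ∈ Icc (0 : ℝ) 1 := by
  have := p.losProb_mem r hr
  cases ν
  · exact this
  · exact ⟨sub_nonneg.2 this.2, sub_le_self _ this.1⟩

lemma measurable_linkProb (ν : Link) : Measurable (p.linkProb ν) := by
  cases ν
  · exact p.measurable_losProb
  · exact p.measurable_losProb.const_sub 1

/-- The link condition of a base station. -/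
noncomputable def stationLink (z : Station) : Link :=
  if z.2.1 ≤ p.losProb ‖z.1.2‖ then Link.los else Link.nlos

/-- The biased received power of a base station. -/
noncomputable def stationPower (z : Station) : ℝ := p.biasedPower z.1.1 (p.stationLink z) ‖z.1.2‖

lemma measurable_stationLink : Measurable p.stationLink :=
  Measurable.ite (measurableSet_le (by fun_prop) (p.measurable_losProb.comp (by fun_prop)))
    measurable_const measurable_const

lemma measurable_biasedPower (k : Tier) (ν : Link) : Measurable (p.biasedPower k ν) := by
  unfold biasedPower pathLoss; fun_prop

lemma measurable_stationPower : Measurable p.stationPower := by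
  have h : Measurable fun a : (Tier × Link) × ℝ => p.biasedPower a.1.1 a.1.2 a.2 :=
    measurable_from_prod_countable_right fun q => p.measurable_biasedPower q.1 q.2
  exact h.comp (((by fun_prop : Measurable fun z : Station => z.1.1).prodMk
    p.measurable_stationLink).prodMk (by fun_prop))

/-- The intensity measure of the process of base stations. -/
noncomputable def intensity : Measure Station :=
  (Measure.sum fun k => (ENNReal.ofReal (p.lam k) • (volume : Measure Plane)).map (Prod.mk k)).prod
    ((volume.restrict (Icc (0 : ℝ) 1)).prod (expMeasure 1))

instance : IsProbabilityMeasure (volume.restrict (Icc (0 : ℝ) 1)) := ⟨by simp⟩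
instance : IsProbabilityMeasure (expMeasure 1) := isProbabilityMeasure_expMeasure one_pos

instance : SigmaFinite (Measure.sum fun k =>
    (ENNReal.ofReal (p.lam k) • (volume : Measure Plane)).map (Prod.mk k)) := by
  refine ⟨⟨⟨fun n => univ ×ˢ Metric.ball 0 n, fun n => trivial, fun n => ?_, ?_⟩⟩⟩
  · have hm : MeasurableSet ((univ : Set Tier) ×ˢ Metric.ball (0 : Plane) n) :=
      MeasurableSet.univ.prod Metric.isOpen_ball.measurableSet
    rw [Measure.sum_apply _ hm, tsum_fintype, ENNReal.sum_lt_top]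
    intro k _
    rw [Measure.map_apply measurable_prodMk_left hm, mk_preimage_prod_right (mem_univ _),
      Measure.smul_apply, smul_eq_mul]
    exact ENNReal.mul_lt_top ENNReal.ofReal_lt_top measure_ball_lt_top
  · rw [← prod_iUnion, Metric.iUnion_ball_nat, univ_prod_univ]

instance : SigmaFinite p.intensity := by unfold intensity; infer_instance

/-- The threshold `losProb x` lies in [0, 1], so the uniform variable falls below it with exactly
that probability. -/
lemma lintegral_link {x : ℝ} (hx : 0 ≤ x) (F : Link → ℝ≥0∞) :
    ∫⁻ u in Icc (0 : ℝ) 1, F (if u ≤ p.losProb x then Link.los else Link.nlos) =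
      ∑ ν, ENNReal.ofReal (p.linkProb ν x) * F ν := by
  have hp := p.losProb_mem x hx
  have hm : Measurable fun u : ℝ => F (if u ≤ p.losProb x then Link.los else Link.nlos) :=
    (measurable_of_countable F).comp
      (Measurable.ite measurableSet_Iic measurable_const measurable_const)
  have hsplit : Icc (0 : ℝ) 1 = Icc 0 (p.losProb x) ∪ Ioc (p.losProb x) 1 :=
    (Icc_union_Ioc_eq_Icc hp.1 hp.2).symm
  rw [hsplit, lintegral_union measurableSet_Ioc (by
    rw [disjoint_left]; intro u h1 h2; exact absurd h1.2 (not_le.2 h2.1))]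
  rw [setLIntegral_congr_fun (g := fun _ => F Link.los) measurableSet_Icc (fun u hu => by
    simp [hu.2])]
  rw [setLIntegral_congr_fun (g := fun _ => F Link.nlos) measurableSet_Ioc (fun u hu => by
    simp [not_le.2 hu.1])]
  have : (Finset.univ : Finset Link) = {Link.los, Link.nlos} := rfl
  rw [this, Finset.sum_pair (by simp)]
  simp [linkProb, mul_comm]

/-- Integrals over base stations of functions of the tier, the link condition and the distance. -/
lemma lintegral_intensity {F : Tier → Link → ℝ → ℝ≥0∞} (hF : ∀ k ν, Measurable (F k ν)) :
    ∫⁻ z, F z.1.1 (p.stationLink z) ‖z.1.2‖ ∂p.intensity =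
      ∑ k, ∑ ν, ∫⁻ r in Ioi (0 : ℝ),
        ENNReal.ofReal (2 * Real.pi * p.lam k * r * p.linkProb ν r) * F k ν r := by
  have hF' : Measurable fun a : (Tier × Link) × ℝ => F a.1.1 a.1.2 a.2 :=
    measurable_from_prod_countable_right fun q => hF q.1 q.2
  have hm : Measurable fun z : Station => F z.1.1 (p.stationLink z) ‖z.1.2‖ :=
    hF'.comp (((by fun_prop : Measurable fun z : Station => z.1.1).prodMk
      p.measurable_stationLink).prodMk (by fun_prop))
  have hlp := p.measurable_linkProb
  rw [intensity, lintegral_prod _ hm.aemeasurable]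
  have h1 : ∀ a : Tier × Plane, ∫⁻ b : ℝ × ℝ, F a.1 (p.stationLink (a, b)) ‖a.2‖
      ∂((volume.restrict (Icc (0 : ℝ) 1)).prod (expMeasure 1)) =
      ∑ ν, ENNReal.ofReal (p.linkProb ν ‖a.2‖) * F a.1 ν ‖a.2‖ := by
    intro a
    have hma : Measurable fun b : ℝ × ℝ => F a.1 (p.stationLink (a, b)) ‖a.2‖ :=
      hm.comp measurable_prodMk_left
    rw [lintegral_prod _ hma.aemeasurable]
    refine (lintegral_congr fun u => (lintegral_const (F a.1
      (if u ≤ p.losProb ‖a.2‖ then Link.los else Link.nlos) ‖a.2‖)).trans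
        (by rw [measure_univ, mul_one])).trans ?_
    exact p.lintegral_link (norm_nonneg _) fun ν => F a.1 ν ‖a.2‖
  simp only [h1]
  rw [lintegral_sum_measure, tsum_fintype]
  refine Finset.sum_congr rfl fun k _ => ?_
  have hm2 : ∀ (k : Tier) (ν : Link), Measurable fun r : ℝ =>
      ENNReal.ofReal (p.linkProb ν r) * F k ν r := fun k ν => by
    have := hlp ν; have := hF k ν; fun_prop
  have hm3 : Measurable fun a : Tier × Plane =>
      ∑ ν, ENNReal.ofReal (p.linkProb ν ‖a.2‖) * F a.1 ν ‖a.2‖ :=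
    measurable_from_prod_countable_right fun k =>
      Finset.measurable_fun_sum _ fun ν _ => (hm2 k ν).comp measurable_norm
  have hm4 : ∀ ν, Measurable fun x : Plane => ENNReal.ofReal (p.linkProb ν ‖x‖) * F k ν ‖x‖ :=
    fun ν => (hm2 k ν).comp measurable_norm
  rw [lintegral_map hm3 measurable_prodMk_left, lintegral_smul_measure,
    lintegral_finsetSum _ fun ν _ => hm4 ν, smul_eq_mul, Finset.mul_sum]
  refine Finset.sum_congr rfl fun ν _ => ?_
  rw [lintegral_fun_norm_plane (hm2 k ν), ← lintegral_const_mul _ (by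
    have := hm2 k ν; fun_prop)]
  refine setLIntegral_congr_fun measurableSet_Ioi fun r hr => ?_
  have hr' : (0 : ℝ) < r := hr
  rw [← mul_assoc, ← mul_assoc, ← ENNReal.ofReal_mul (p.lam_pos k).le,
    ← ENNReal.ofReal_mul (mul_nonneg (p.lam_pos k).le (by positivity))]
  congr 2; ring

end Params

/-! ### Sources of randomness and the marked Poisson network -/

namespace Network

variable {Ω : Type*} [mΩ : MeasurableSpace Ω] {P : Measure Ω} {p : Params} (N : Network P p)

/-- The sources of randomness: the two point processes, the blockage variables and the fading
variables. -/
abbrev Source : Type := Tier ⊕ (Tier × ℕ) ⊕ (Tier × ℕ)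

/-- The σ-algebra generated by one source of randomness. -/
abbrev sourceSpace : Source → MeasurableSpace Ω :=
  Sum.elim (fun k : Tier => MeasurableSpace.comap (fun ω n => N.X k n ω) inferInstance)
    (Sum.elim (fun q : Tier × ℕ => MeasurableSpace.comap (N.U q.1 q.2) inferInstance)
      (fun q : Tier × ℕ => MeasurableSpace.comap (N.h q.1 q.2) inferInstance))

/-- The σ-algebra generated by a set of sources of randomness. -/
abbrev sourcesSpace (S : Set Source) : MeasurableSpace Ω := ⨆ j ∈ S, N.sourceSpace j

lemma sourceSpace_le (j : Source) : N.sourceSpace j ≤ mΩ := by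
  rcases j with k | q | q
  · exact (measurable_pi_lambda _ fun n => N.measurable_X k n).comap_le
  · exact (N.measurable_U q.1 q.2).comap_le
  · exact (N.measurable_h q.1 q.2).comap_le

lemma sourcesSpace_le (S : Set Source) : N.sourcesSpace S ≤ mΩ :=
  iSup₂_le fun j _ => N.sourceSpace_le j

lemma indep_sourcesSpace {S T : Set Source} (h : Disjoint S T) :
    Indep (N.sourcesSpace S) (N.sourcesSpace T) P :=
  indep_iSup_of_disjoint N.sourceSpace_le N.indep h

lemma measurable_X_sources {S : Set Source} {k : Tier} (h : Sum.inl k ∈ S) (n : ℕ) :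
    Measurable[N.sourcesSpace S] (N.X k n) := by
  have h1 : Measurable[N.sourceSpace (Sum.inl k)] (fun ω n => N.X k n ω) :=
    comap_measurable _
  exact ((measurable_pi_apply n).comp h1).mono (le_iSup₂ (f := fun j _ => N.sourceSpace j) _ h)
    le_rfl

lemma measurable_U_sources {S : Set Source} {q : Tier × ℕ} (h : Sum.inr (Sum.inl q) ∈ S) :
    Measurable[N.sourcesSpace S] (N.U q.1 q.2) := by
  have h1 : Measurable[N.sourceSpace (Sum.inr (Sum.inl q))] (N.U q.1 q.2) := comap_measurable _
  exact h1.mono (le_iSup₂ (f := fun j _ => N.sourceSpace j) _ h) le_rfl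

lemma measurable_h_sources {S : Set Source} {q : Tier × ℕ} (h : Sum.inr (Sum.inr q) ∈ S) :
    Measurable[N.sourcesSpace S] (N.h q.1 q.2) := by
  have h1 : Measurable[N.sourceSpace (Sum.inr (Sum.inr q))] (N.h q.1 q.2) := comap_measurable _
  exact h1.mono (le_iSup₂ (f := fun j _ => N.sourceSpace j) _ h) le_rfl

/-- The base station with a given tier and number. -/
def station (q : Tier × ℕ) (ω : Ω) : Station :=
  ((q.1, N.X q.1 q.2 ω), (N.U q.1 q.2 ω, N.h q.1 q.2 ω))

lemma measurable_station (q : Tier × ℕ) : Measurable (N.station q) :=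
  (measurable_const.prodMk (N.measurable_X q.1 q.2)).prodMk
    ((N.measurable_U q.1 q.2).prodMk (N.measurable_h q.1 q.2))

lemma stationPower_station (q : Tier × ℕ) (ω : Ω) :
    p.stationPower (N.station q ω) = N.power q.1 q.2 ω := rfl

/-- The base stations form a marked Poisson process. -/
lemma hasPoissonLaplace [IsProbabilityMeasure P] :
    HasPoissonLaplace P N.station p.intensity := by
  have hX : iIndepFun (fun k ω n => N.X k n ω) P := by
    have := N.indep.precomp (g := (Sum.inl : Tier → Source)) Sum.inl_injective
    exact this
  have h1 := HasPoissonLaplace.superpose (P := P) (X := N.X) N.measurable_X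
    (fun k => (N.poisson k).hasPoissonLaplace (p.lam_pos k).le (N.measurable_X k)) hX
  -- For each station, the σ-algebra required by marking is the one generated by all sources except
  -- its own two marks.
  refine HasPoissonLaplace.marked (μ := (volume.restrict (Icc (0 : ℝ) 1)).prod (expMeasure 1)) h1
    (Y := fun q ω => (N.U q.1 q.2 ω, N.h q.1 q.2 ω)) ?_ ?_ ?_
    (fun q => N.sourcesSpace {Sum.inr (Sum.inl q), Sum.inr (Sum.inr q)}ᶜ)
    (fun q => N.sourcesSpace_le _) ?_ ?_ ?_
  · exact fun q => measurable_const.prodMk (N.measurable_X q.1 q.2)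
  · exact fun q => (N.measurable_U q.1 q.2).prodMk (N.measurable_h q.1 q.2)
  · intro q
    have hi : IndepFun (N.U q.1 q.2) (N.h q.1 q.2) P :=
      N.indep.indep (i := Sum.inr (Sum.inl q)) (j := Sum.inr (Sum.inr q)) (by simp)
    rw [indepFun_iff_map_prod_eq_prod_map_map (N.measurable_U _ _).aemeasurable
      (N.measurable_h _ _).aemeasurable, N.U_law, N.h_law] at hi
    exact hi
  · exact fun q q' => measurable_const.prodMk (N.measurable_X_sources (by simp) _)
  · intro q q' hq
    exact (N.measurable_U_sources (by simpa using hq)).prodMk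
      (N.measurable_h_sources (by simpa using hq))
  · intro q
    refine indep_of_indep_of_le_right (N.indep_sourcesSpace disjoint_compl_left) ?_
    exact ((N.measurable_U_sources (by simp)).prodMk (N.measurable_h_sources (by simp))).comap_le

/-- The fading of one base station is independent of everything else. -/
lemma lintegral_fading [IsProbabilityMeasure P] {E : Type*} [MeasurableSpace E] (q : Tier × ℕ)
    {W : Ω → E} (hW : Measurable[N.sourcesSpace {Sum.inr (Sum.inr q)}ᶜ] W)
    {φ : E × ℝ → ℝ≥0∞} (hφ : Measurable φ) :
    ∫⁻ ω, φ (W ω, N.h q.1 q.2 ω) ∂P = ∫⁻ ω, ∫⁻ y, φ (W ω, y) ∂(expMeasure 1) ∂P := by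
  rw [← N.h_law q.1 q.2]
  refine lintegral_comp_prodMk_of_indep (N.sourcesSpace_le _) (N.measurable_h _ _) ?_ hW hφ
  refine indep_of_indep_of_le_right (N.indep_sourcesSpace disjoint_compl_left) ?_
  exact (N.measurable_h_sources (by simp)).comap_le

end Network

/-! ### Received powers, exclusion radii and ties -/

namespace Params

variable (p : Params)

/-- The biased received power at unit distance is positive. -/
lemma coef_pos (k : Tier) (ν : Link) : 0 < p.Ptr k * p.B k * p.A ν :=
  mul_pos (mul_pos (p.Ptr_pos k) (p.B_pos k)) (p.A_pos ν)

lemma biasedPower_eq (k : Tier) (ν : Link) (r : ℝ) :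
    p.biasedPower k ν r = p.Ptr k * p.B k * p.A ν * r ^ (-p.α ν) := by
  rw [biasedPower, pathLoss, ← mul_assoc]

lemma biasedPower_pos (k : Tier) (ν : Link) {r : ℝ} (hr : 0 < r) : 0 < p.biasedPower k ν r := by
  rw [biasedPower_eq]
  exact mul_pos (p.coef_pos k ν) (Real.rpow_pos_of_pos hr _)

lemma biasedPower_strictAntiOn (k : Tier) (ν : Link) :
    StrictAntiOn (p.biasedPower k ν) (Ioi 0) := by
  intro a ha b hb hab
  rw [biasedPower_eq, biasedPower_eq]
  exact mul_lt_mul_of_pos_left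
    (Real.rpow_lt_rpow_of_neg ha hab (neg_lt_zero.2 (p.α_pos ν))) (p.coef_pos k ν)

lemma continuousAt_biasedPower (k : Tier) (ν : Link) {r : ℝ} (hr : 0 < r) :
    ContinuousAt (p.biasedPower k ν) r := by
  have : p.biasedPower k ν = fun r => p.Ptr k * p.B k * p.A ν * r ^ (-p.α ν) :=
    funext (p.biasedPower_eq k ν)
  rw [this]
  exact continuousAt_const.mul (Real.continuousAt_rpow_const _ _ (Or.inl hr.ne'))

lemma exclusionRadius_pos (k : Tier) (ν : Link) (j : Tier) (μ : Link) {r : ℝ} (hr : 0 < r) :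
    0 < p.exclusionRadius k ν j μ r :=
  mul_pos (Real.rpow_pos_of_pos (div_pos (p.coef_pos j μ) (p.coef_pos k ν)) _)
    (Real.rpow_pos_of_pos hr _)

lemma exclusionRadius_self (k : Tier) (ν : Link) (r : ℝ) : p.exclusionRadius k ν k ν r = r := by
  rw [exclusionRadius, div_self (p.coef_pos k ν).ne', div_self (p.α_pos ν).ne', Real.one_rpow,
    one_mul, Real.rpow_one]

lemma biasedPower_exclusionRadius (k : Tier) (ν : Link) (j : Tier) (μ : Link) {r : ℝ}
    (hr : 0 < r) : p.biasedPower j μ (p.exclusionRadius k ν j μ r) = p.biasedPower k ν r := by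
  have hC := p.coef_pos j μ
  have hD := p.coef_pos k ν
  have hα := (p.α_pos μ).ne'
  rw [biasedPower_eq, biasedPower_eq, exclusionRadius,
    Real.mul_rpow (Real.rpow_nonneg (div_pos hC hD).le _) (Real.rpow_nonneg hr.le _),
    ← Real.rpow_mul (div_pos hC hD).le, ← Real.rpow_mul hr.le]
  have e1 : 1 / p.α μ * -p.α μ = -1 := by field_simp
  have e2 : p.α ν / p.α μ * -p.α μ = -p.α ν := by field_simp
  rw [e1, e2, Real.rpow_neg_one, inv_div, ← mul_assoc, mul_div_cancel₀ _ hC.ne']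

/-- Power is strictly decreasing in distance and the exclusion radius is the distance of equal
power. -/
lemma biasedPower_lt_iff (k : Tier) (ν : Link) (j : Tier) (μ : Link) {r u : ℝ} (hr : 0 < r)
    (hu : 0 < u) : p.biasedPower k ν r < p.biasedPower j μ u ↔ u < p.exclusionRadius k ν j μ r := by
  rw [← p.biasedPower_exclusionRadius k ν j μ hr]
  exact (p.biasedPower_strictAntiOn j μ).lt_iff_gt (p.exclusionRadius_pos k ν j μ hr) hu

lemma nearestRate_nonneg (j : Tier) (μ : Link) {u : ℝ} (hu : 0 ≤ u) :
    0 ≤ 2 * Real.pi * p.lam j * u * p.linkProb μ u :=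
  mul_nonneg (mul_nonneg (mul_nonneg (by positivity) (p.lam_pos j).le) hu)
    (p.linkProb_mem μ u hu).1

lemma intervalIntegrable_nearestRate (j : Tier) (μ : Link) {R : ℝ} (hR : 0 ≤ R) :
    IntervalIntegrable (fun u => 2 * Real.pi * p.lam j * u * p.linkProb μ u) volume 0 R := by
  have hc : Continuous fun u : ℝ => 2 * Real.pi * p.lam j * u := by fun_prop
  refine (hc.intervalIntegrable 0 R).mono_fun' ?_ ?_
  · exact (hc.measurable.mul (p.measurable_linkProb μ)).aestronglyMeasurable
  · rw [uIoc_of_le hR]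
    refine (ae_restrict_iff' measurableSet_Ioc).2 (Eventually.of_forall fun u hu => ?_)
    have h := p.linkProb_mem μ u hu.1.le
    have h0 : 0 ≤ 2 * Real.pi * p.lam j * u :=
      mul_nonneg (mul_nonneg (by positivity) (p.lam_pos j).le) hu.1.le
    change ‖2 * Real.pi * p.lam j * u * p.linkProb μ u‖ ≤ 2 * Real.pi * p.lam j * u
    rw [Real.norm_eq_abs, abs_of_nonneg (p.nearestRate_nonneg j μ hu.1.le)]
    exact mul_le_of_le_one_right h0 h.2

lemma negExp_setLIntegral_nearestRate (j : Tier) (μ : Link) {R : ℝ} (hR : 0 ≤ R) :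
    negExp (∫⁻ u in Ioo 0 R, ENNReal.ofReal (2 * Real.pi * p.lam j * u * p.linkProb μ u)) =
      ENNReal.ofReal (p.voidProb j μ R) := by
  have hi := (intervalIntegrable_iff_integrableOn_Ioc_of_le hR).1
    (p.intervalIntegrable_nearestRate j μ hR)
  rw [Measure.restrict_congr_set Ioo_ae_eq_Ioc, ← ofReal_integral_eq_lintegral_ofReal hi
    ((ae_restrict_iff' measurableSet_Ioc).2 (Eventually.of_forall fun u hu =>
      p.nearestRate_nonneg j μ hu.1.le)), negExp_ofReal, voidProb,
    intervalIntegral.integral_of_le hR]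
  exact setIntegral_nonneg measurableSet_Ioc fun u hu => p.nearestRate_nonneg j μ hu.1.le

/-- The probability that no base station is received more strongly than one of tier `k` with link
condition `ν` at distance `r`. -/
lemma negExp_intensity_stronger (k : Tier) (ν : Link) {r : ℝ} (hr : 0 < r) :
    negExp (p.intensity {z | p.biasedPower k ν r < p.stationPower z}) =
      ENNReal.ofReal (∏ q : Tier × Link, p.voidProb q.1 q.2 (p.exclusionRadius k ν q.1 q.2 r)) := by
  have hm : MeasurableSet {z | p.biasedPower k ν r < p.stationPower z} :=
    measurableSet_lt measurable_const p.measurable_stationPower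
  have hF : ∀ j μ, MeasurableSet {u | p.biasedPower k ν r < p.biasedPower j μ u} := fun j μ =>
    measurableSet_lt measurable_const (p.measurable_biasedPower j μ)
  have h1 := p.lintegral_intensity
    (F := fun j μ => {u | p.biasedPower k ν r < p.biasedPower j μ u}.indicator fun _ => 1)
    fun j μ => measurable_const.indicator (hF j μ)
  have h2 : p.intensity {z | p.biasedPower k ν r < p.stationPower z} = ∫⁻ z,
      {u | p.biasedPower k ν r < p.biasedPower z.1.1 (p.stationLink z) u}.indicator
        (fun _ => (1 : ℝ≥0∞)) ‖z.1.2‖ ∂p.intensity := by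
    rw [← lintegral_indicator_one hm]
    rfl
  -- The intensity of stronger stations is a sum over the four combinations of tier and link
  -- condition, so its exponential is a product of void probabilities.
  rw [h2, h1, ← Fintype.sum_prod_type', negExp_sum, ENNReal.ofReal_prod_of_nonneg
    (f := fun q : Tier × Link => p.voidProb q.1 q.2 (p.exclusionRadius k ν q.1 q.2 r))
    (fun q _ => (Real.exp_pos _).le)]
  refine Finset.prod_congr rfl fun q _ => ?_
  rw [← p.negExp_setLIntegral_nearestRate q.1 q.2 (p.exclusionRadius_pos k ν q.1 q.2 hr).le]
  congr 1
  have e : Ioo 0 (p.exclusionRadius k ν q.1 q.2 r) =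
      Iio (p.exclusionRadius k ν q.1 q.2 r) ∩ Ioi 0 := by
    ext u; simp [and_comm]
  rw [e, ← setLIntegral_indicator measurableSet_Iio]
  refine setLIntegral_congr_fun measurableSet_Ioi fun u hu => ?_
  have hiff := p.biasedPower_lt_iff k ν q.1 q.2 hr hu
  by_cases h : u < p.exclusionRadius k ν q.1 q.2 r
  · simp [h, hiff.2 h]
  · simp [h, hiff.not.2 h]

/-- The exclusion radius for the serving combination is r itself, so the void probability inside
`nearestPDF` supplies the erased factor. -/
lemma assocDensity_eq (k : Tier) (ν : Link) (r : ℝ) :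
    p.assocDensity k ν r = 2 * Real.pi * p.lam k * r * p.linkProb ν r *
      ∏ q : Tier × Link, p.voidProb q.1 q.2 (p.exclusionRadius k ν q.1 q.2 r) := by
  rw [assocDensity, nearestPDF, mul_assoc, ← Finset.mul_prod_erase _ _ (Finset.mem_univ (k, ν)),
    exclusionRadius_self]

lemma assocDensity_nonneg (k : Tier) (ν : Link) {r : ℝ} (hr : 0 ≤ r) :
    0 ≤ p.assocDensity k ν r := by
  rw [assocDensity_eq]
  exact mul_nonneg (p.nearestRate_nonneg k ν hr)
    (Finset.prod_nonneg fun q _ => (Real.exp_pos _).le)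

/-- For each tier and link condition the power is injective in the positive distance, so at most one
radius attains t. -/
lemma intensity_stationPower_eq_zero (t : ℝ) :
    p.intensity {z | p.stationPower z = t} = 0 := by
  have hm : MeasurableSet {z | p.stationPower z = t} :=
    measurableSet_eq_fun p.measurable_stationPower measurable_const
  have hF : ∀ j μ, MeasurableSet {u | p.biasedPower j μ u = t} := fun j μ =>
    measurableSet_eq_fun (p.measurable_biasedPower j μ) measurable_const
  have h1 := p.lintegral_intensity
    (F := fun j μ => {u | p.biasedPower j μ u = t}.indicator fun _ => 1)
    fun j μ => measurable_const.indicator (hF j μ)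
  have h2 : p.intensity {z | p.stationPower z = t} = ∫⁻ z,
      {u | p.biasedPower z.1.1 (p.stationLink z) u = t}.indicator
        (fun _ => (1 : ℝ≥0∞)) ‖z.1.2‖ ∂p.intensity := by
    rw [← lintegral_indicator_one hm]
    rfl
  rw [h2, h1]
  refine Finset.sum_eq_zero fun j _ => Finset.sum_eq_zero fun μ _ => ?_
  have hs : (Ioi (0 : ℝ) ∩ {u | p.biasedPower j μ u = t}).Subsingleton := fun a ha b hb =>
    (p.biasedPower_strictAntiOn j μ).injOn ha.1 hb.1 (ha.2.trans hb.2.symm)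
  have h0 : volume (Ioi (0 : ℝ) ∩ {u | p.biasedPower j μ u = t}) = 0 := hs.measure_zero _
  rw [← lintegral_indicator measurableSet_Ioi]
  refine (lintegral_congr_ae ?_).trans lintegral_zero
  filter_upwards [measure_eq_zero_iff_ae_notMem.1 h0] with u hu
  by_cases hu0 : u ∈ Ioi (0 : ℝ)
  · have : ¬ p.biasedPower j μ u = t := fun h => hu ⟨hu0, h⟩
    simp [this]
  · simp [hu0]

lemma intensity_norm_eq_zero : p.intensity {z | ‖z.1.2‖ = 0} = 0 := by
  have hm : MeasurableSet {z : Station | ‖z.1.2‖ = 0} :=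
    measurableSet_eq_fun (by fun_prop) measurable_const
  have h1 := p.lintegral_intensity
    (F := fun _ _ => ({0} : Set ℝ).indicator fun _ => 1)
    fun j μ => measurable_const.indicator (measurableSet_singleton _)
  have h2 : p.intensity {z | ‖z.1.2‖ = 0} = ∫⁻ z : Station,
      ({0} : Set ℝ).indicator (fun _ => (1 : ℝ≥0∞)) ‖z.1.2‖ ∂p.intensity := by
    rw [← lintegral_indicator_one hm]
    rfl
  rw [h2, h1]
  refine Finset.sum_eq_zero fun j _ => Finset.sum_eq_zero fun μ _ => ?_
  rw [← lintegral_indicator measurableSet_Ioi]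
  refine (lintegral_congr fun u => ?_).trans lintegral_zero
  by_cases hu0 : u ∈ Ioi (0 : ℝ)
  · have : u ≠ 0 := ne_of_gt hu0
    simp [this]
  · simp [hu0]

lemma measurableSet_tie :
    MeasurableSet {a : Station × Station | p.stationPower a.1 = p.stationPower a.2} :=
  measurableSet_eq_fun (p.measurable_stationPower.comp measurable_fst)
    (p.measurable_stationPower.comp measurable_snd)

/-- By Fubini: each slice is a level set of the power, which is null. -/
lemma intensity_prod_tie :
    p.intensity.prod p.intensity {a | p.stationPower a.1 = p.stationPower a.2} = 0 := by
  rw [Measure.measure_prod_null p.measurableSet_tie]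
  refine Eventually.of_forall fun z => ?_
  refine measure_mono_null (fun z' hz' => ?_) (p.intensity_stationPower_eq_zero (p.stationPower z))
  exact (Eq.symm hz' :)

end Params

namespace Network

variable {Ω : Type*} [mΩ : MeasurableSpace Ω] {P : Measure Ω} {p : Params} (N : Network P p)
  [IsProbabilityMeasure P]

/-- Almost surely no base station is located at the user. -/
lemma ae_dist_pos : ∀ᵐ ω ∂P, ∀ q : Tier × ℕ, 0 < N.dist q.1 q.2 ω := by
  have hm : MeasurableSet {z : Station | ‖z.1.2‖ = 0} :=
    measurableSet_eq_fun (by fun_prop) measurable_const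
  -- Campbell's formula: the expected number of stations at the origin is its intensity, which is
  -- zero.
  have h := N.hasPoissonLaplace.tsum_lintegral N.measurable_station
    (measurable_one.indicator hm)
  rw [lintegral_indicator_one hm, p.intensity_norm_eq_zero, ENNReal.tsum_eq_zero] at h
  rw [ae_all_iff]
  intro q
  have hq := h q
  have hmq : Measurable fun ω => {z : Station | ‖z.1.2‖ = 0}.indicator (1 : Station → ℝ≥0∞)
      (N.station q ω) := (measurable_one.indicator hm).comp (N.measurable_station q)
  rw [lintegral_eq_zero_iff hmq] at hq
  filter_upwards [hq] with ω hω
  refine lt_of_le_of_ne (norm_nonneg _) fun h0 => ?_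
  have : N.station q ω ∈ {z : Station | ‖z.1.2‖ = 0} := h0.symm
  simp only [Pi.zero_apply, indicator_of_mem this, Pi.one_apply, one_ne_zero] at hω

/-- Almost surely at most one base station serves the user. -/
lemma ae_serves_unique : ∀ᵐ ω ∂P, ∀ q q' : Tier × ℕ,
    N.Serves q.1 q.2 ω → N.Serves q'.1 q'.2 ω → q = q' := by
  filter_upwards [N.hasPoissonLaplace.ae_pair_notMem N.measurable_station p.measurableSet_tie
    p.intensity_prod_tie] with ω hω q q' hq hq'
  by_contra hne
  exact hω q q' (Ne.symm hne) (le_antisymm (hq' q.1 q.2) (hq q'.1 q'.2))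

end Network

/-! ### Service and interference as one exponential functional -/

namespace Params

variable (p : Params)

/-- Received power, in units of `Ptr k * B k * A ν`. -/
noncomputable def stationGain (k : Tier) (ν : Link) (z : Station) : ℝ≥0∞ :=
  ENNReal.ofReal (z.2.2 * p.stationPower z) / ENNReal.ofReal (p.Ptr k * p.B k * p.A ν)

lemma measurable_stationGain (k : Tier) (ν : Link) : Measurable (p.stationGain k ν) := by
  have := p.measurable_stationPower
  unfold stationGain; fun_prop

lemma stationGain_ne_top (k : Tier) (ν : Link) (z : Station) : p.stationGain k ν z ≠ ∞ :=
  ENNReal.div_ne_top ENNReal.ofReal_ne_top (by simpa using p.coef_pos k ν)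

/-- The exponent of the interference functional, infinite on the base stations that are received
more strongly than the serving one. -/
noncomputable def exponent (k : Tier) (ν : Link) (s : ℝ → ℝ) (r : ℝ) (z : Station) : ℝ≥0∞ :=
  if p.stationPower z ≤ p.biasedPower k ν r then ENNReal.ofReal (s r) * p.stationGain k ν z else ∞

lemma measurable_exponent (k : Tier) (ν : Link) {s : ℝ → ℝ} (hs : Measurable s) :
    Measurable (Function.uncurry (p.exponent k ν s)) := by
  refine Measurable.ite (measurableSet_le (p.measurable_stationPower.comp measurable_snd)
    ((p.measurable_biasedPower k ν).comp measurable_fst)) ?_ measurable_const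
  exact ((hs.comp measurable_fst).ennreal_ofReal).mul
    ((p.measurable_stationGain k ν).comp measurable_snd)

/-- A larger r lowers the power threshold, which only enlarges the set where the exponent is
infinite, and it raises s. -/
lemma exponent_mono (k : Tier) (ν : Link) {s : ℝ → ℝ} (hs : MonotoneOn s (Ioi 0)) (z : Station)
    (r r' : ℝ) (hr : 0 < r) (hrr : r ≤ r') : p.exponent k ν s r z ≤ p.exponent k ν s r' z := by
  have hr' : 0 < r' := hr.trans_le hrr
  unfold exponent
  by_cases h : p.stationPower z ≤ p.biasedPower k ν r'
  · rw [if_pos h, if_pos (h.trans ((p.biasedPower_strictAntiOn k ν).antitoneOn hr hr' hrr))]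
    gcongr
    exact hs hr hr' hrr
  · rw [if_neg h]; exact le_top

/-- Left continuity is the right notion: a station exactly at the threshold for r stays below it for
all smaller t, while from the right it would jump to infinity. -/
lemma tendsto_exponent (k : Tier) (ν : Link) {s : ℝ → ℝ} (hs : ContinuousOn s (Ioi 0))
    (z : Station) (r : ℝ) (hr : 0 < r) :
    Tendsto (fun t => p.exponent k ν s t z) (𝓝[<] r) (𝓝 (p.exponent k ν s r z)) := by
  by_cases h : p.stationPower z ≤ p.biasedPower k ν r
  · have h1 : Tendsto (fun t => ENNReal.ofReal (s t) * p.stationGain k ν z) (𝓝[<] r)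
        (𝓝 (p.exponent k ν s r z)) := by
      rw [exponent, if_pos h]
      refine ENNReal.Tendsto.mul_const ?_ (Or.inr (p.stationGain_ne_top k ν z))
      exact (ENNReal.continuous_ofReal.tendsto _).comp
        ((hs.continuousAt (Ioi_mem_nhds hr)).tendsto.mono_left nhdsWithin_le_nhds)
    refine h1.congr' ?_
    filter_upwards [self_mem_nhdsWithin, mem_nhdsWithin_of_mem_nhds (lt_mem_nhds hr)] with t ht ht0
    rw [exponent, if_pos]
    exact h.trans ((p.biasedPower_strictAntiOn k ν).antitoneOn ht0 hr (le_of_lt ht))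
  · have h2 : ∀ᶠ t in 𝓝[<] r, p.biasedPower k ν t < p.stationPower z :=
      mem_nhdsWithin_of_mem_nhds
        ((p.continuousAt_biasedPower k ν hr).eventually_lt continuousAt_const (not_le.1 h))
    rw [exponent, if_neg h]
    refine tendsto_const_nhds.congr' ?_
    filter_upwards [h2] with t ht
    rw [exponent, if_neg (not_le.2 ht)]

end Params

namespace Network

variable {Ω : Type*} [mΩ : MeasurableSpace Ω] {P : Measure Ω} {p : Params} (N : Network P p)

lemma measurable_power (k : Tier) (n : ℕ) : Measurable (N.power k n) :=
  p.measurable_stationPower.comp (N.measurable_station (k, n))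

lemma measurable_dist (k : Tier) (n : ℕ) : Measurable (N.dist k n) :=
  (N.measurable_X k n).norm

lemma measurable_link (k : Tier) (n : ℕ) : Measurable (N.link k n) :=
  p.measurable_stationLink.comp (N.measurable_station (k, n))

lemma measurable_interferenceAt (k : Tier) (ν : Link) :
    Measurable fun a : ℝ × Ω => N.interferenceAt k ν a.1 a.2 := by
  unfold interferenceAt
  refine Measurable.tsum fun q => Measurable.ite (measurableSet_le
    ((N.measurable_power q.1 q.2).comp measurable_snd)
    ((p.measurable_biasedPower k ν).comp measurable_fst)) ?_ measurable_const
  exact (((N.measurable_h q.1 q.2).mul (N.measurable_power q.1 q.2)).comp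
    measurable_snd).ennreal_ofReal

lemma measurable_laplace_integrand (k : Tier) (ν : Link) {s : ℝ → ℝ} (hs : Measurable s) :
    Measurable fun a : ℝ × Ω => expNeg (ENNReal.ofReal (s a.1) *
      (N.interferenceAt k ν a.1 a.2 / ENNReal.ofReal (p.Ptr k * p.B k * p.A ν))) :=
  measurable_expNeg.comp (((hs.comp measurable_fst).ennreal_ofReal).mul
    ((N.measurable_interferenceAt k ν).div_const _))

lemma expNeg_nonneg (x : ℝ≥0∞) : 0 ≤ expNeg x := by
  unfold expNeg; split_ifs <;> positivity

lemma laplace_nonneg (k : Tier) (ν : Link) (r s : ℝ) : 0 ≤ N.laplace k ν r s :=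
  integral_nonneg fun _ => expNeg_nonneg _

/-- A single station stronger than the candidate makes the sum infinite and the exponential zero, so
the indicator of service is built in. Without one, every exponent is finite and the sum is the
normalized interference. -/
lemma negExp_tsum_exponent (k : Tier) (ν : Link) (s : ℝ → ℝ) (n : ℕ) (ω : Ω)
    (hl : N.link k n ω = ν) :
    negExp (∑' q, if q = (k, n) then 0 else
        p.exponent k ν s (N.dist k n ω) (N.station q ω)) =
      {ω | N.Serves k n ω}.indicator (fun ω => negExp (ENNReal.ofReal (s (N.dist k n ω)) *
        (N.interference k n ω / ENNReal.ofReal (p.Ptr k * p.B k * p.A ν)))) ω := by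
  have hpow : p.biasedPower k ν (N.dist k n ω) = N.power k n ω := by rw [power, hl]
  by_cases hS : N.Serves k n ω
  · rw [indicator_of_mem (show ω ∈ {ω | N.Serves k n ω} from hS), interference, div_eq_mul_inv,
      ← ENNReal.tsum_mul_right, ← ENNReal.tsum_mul_left]
    congr 1
    refine tsum_congr fun q => ?_
    split_ifs
    · simp
    · rw [Params.exponent, if_pos (by rw [hpow]; exact hS q.1 q.2)]
      rfl
  · rw [indicator_of_notMem (show ω ∉ {ω | N.Serves k n ω} from hS), negExp_eq_zero_iff]
    simp only [Serves, not_forall, not_le] at hS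
    obtain ⟨j, i, hji⟩ := hS
    refine ENNReal.tsum_eq_top_of_eq_top ⟨(j, i), ?_⟩
    rw [if_neg, Params.exponent, if_neg]
    · rw [hpow, not_le]; exact hji
    · rintro h
      rw [Prod.mk.injEq] at h
      obtain ⟨rfl, rfl⟩ := h
      exact lt_irrefl _ hji

variable [IsProbabilityMeasure P]

lemma measurable_laplace (k : Tier) (ν : Link) {s : ℝ → ℝ} (hs : Measurable s) :
    Measurable fun r => N.laplace k ν r (s r) :=
  ((N.measurable_laplace_integrand k ν hs).stronglyMeasurable.integral_prod_right').measurable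

lemma ofReal_laplace (k : Tier) (ν : Link) (r s : ℝ) :
    ENNReal.ofReal (N.laplace k ν r s) =
      ∫⁻ ω, negExp (∑' q, if p.stationPower (N.station q ω) ≤ p.biasedPower k ν r then
        ENNReal.ofReal s * p.stationGain k ν (N.station q ω) else 0) ∂P := by
  have hm := (N.measurable_laplace_integrand k ν (measurable_const (a := s))).comp
    (measurable_prodMk_left (x := r))
  have hi : Integrable (fun ω => expNeg (ENNReal.ofReal s *
      (N.interferenceAt k ν r ω / ENNReal.ofReal (p.Ptr k * p.B k * p.A ν)))) P := by
    refine Integrable.of_bound hm.aestronglyMeasurable 1 (Eventually.of_forall fun ω => ?_)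
    rw [Real.norm_eq_abs, abs_of_nonneg (expNeg_nonneg _)]
    have := negExp_le_one (ENNReal.ofReal s *
      (N.interferenceAt k ν r ω / ENNReal.ofReal (p.Ptr k * p.B k * p.A ν)))
    rwa [negExp_eq_ofReal_expNeg, ENNReal.ofReal_le_one] at this
  rw [laplace, ofReal_integral_eq_lintegral_ofReal hi
    (Eventually.of_forall fun ω => expNeg_nonneg _)]
  refine lintegral_congr fun ω => ?_
  rw [← negExp_eq_ofReal_expNeg, interferenceAt, div_eq_mul_inv, ← ENNReal.tsum_mul_right,
    ← ENNReal.tsum_mul_left]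
  congr 1
  refine tsum_congr fun q => ?_
  rw [stationPower_station]
  split_ifs
  · rfl
  · simp

/-- The exponential functional of the exponent is the probability that no base station is received
more strongly than the serving one, times the Laplace transform of the interference. -/
lemma lintegral_negExp_exponent (k : Tier) (ν : Link) (s : ℝ → ℝ) (r : ℝ) :
    ∫⁻ ω, negExp (∑' q, p.exponent k ν s r (N.station q ω)) ∂P =
      negExp (p.intensity {z | p.biasedPower k ν r < p.stationPower z}) *
        ENNReal.ofReal (N.laplace k ν r (s r)) := by
  have hms : MeasurableSet {z | p.stationPower z ≤ p.biasedPower k ν r} :=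
    measurableSet_le p.measurable_stationPower measurable_const
  have hmt : MeasurableSet {z | p.biasedPower k ν r < p.stationPower z} :=
    measurableSet_lt measurable_const p.measurable_stationPower
  have hg := p.measurable_stationGain k ν
  have hm1 : Measurable (p.exponent k ν s r) :=
    Measurable.ite hms (by fun_prop) measurable_const
  have hm2 : Measurable fun z => if p.stationPower z ≤ p.biasedPower k ν r then
      ENNReal.ofReal (s r) * p.stationGain k ν z else 0 :=
    Measurable.ite hms (by fun_prop) measurable_const
  rw [ofReal_laplace, N.hasPoissonLaplace _ hm1, N.hasPoissonLaplace _ hm2, ← negExp_add,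
    ← lintegral_indicator_one hmt, ← lintegral_add_left (measurable_one.indicator hmt)]
  congr 1
  refine lintegral_congr fun z => ?_
  -- Pointwise, 1 - e^{-exponent} is 1 on stronger stations and the integrand for the weaker ones
  -- elsewhere. The integrals add in the exponent, hence the expectation factors.
  by_cases h : p.stationPower z ≤ p.biasedPower k ν r
  · simp [Params.exponent, h, indicator, not_lt.2 h]
  · simp [Params.exponent, h, indicator, not_le.1 h]

/-- Integral over the serving base stations of a given tier and link condition of an exponential
functional of the interference. -/
lemma tsum_lintegral_serving (k : Tier) (ν : Link) {s : ℝ → ℝ} (hs : Measurable s)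
    (hsm : MonotoneOn s (Ioi 0)) (hsc : ContinuousOn s (Ioi 0)) {c : ℝ → ℝ≥0∞} (hc : Measurable c)
    (hc1 : ∀ r, c r ≤ 1) {S : Set ℝ} (hS : MeasurableSet S) :
    ∑' n, ∫⁻ ω, {ω | N.Serves k n ω ∧ N.link k n ω = ν ∧ N.dist k n ω ∈ S}.indicator
      (fun ω => c (N.dist k n ω) * negExp (ENNReal.ofReal (s (N.dist k n ω)) *
        (N.interference k n ω / ENNReal.ofReal (p.Ptr k * p.B k * p.A ν)))) ω ∂P =
    ∫⁻ r in S ∩ Ioi 0, c r * ENNReal.ofReal (N.laplace k ν r (s r) * p.assocDensity k ν r) := by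
  have hT : MeasurableSet (S ∩ Ioi (0 : ℝ)) := hS.inter measurableSet_Ioi
  -- Selects the candidate servers. A candidate is not stronger than the threshold at any positive
  -- radius up to its own distance, so its own exponent is finite, as the Mecke formula requires.
  set g : Station → ℝ≥0∞ := fun z => if z.1.1 = k ∧ p.stationLink z = ν then
    (S ∩ Ioi 0).indicator c ‖z.1.2‖ else 0 with hgdef
  have hg : Measurable g := by
    refine Measurable.ite (MeasurableSet.inter ?_ ?_) ((hc.indicator hT).comp (by fun_prop))
      measurable_const
    · exact (by fun_prop : Measurable fun z : Station => z.1.1) (measurableSet_singleton k)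
    · exact p.measurable_stationLink (measurableSet_singleton ν)
  have hg1 : ∀ z, g z ≤ 1 := fun z => by
    simp only [hgdef]
    split_ifs
    · exact (indicator_le_self' (fun _ _ => zero_le) _).trans (hc1 _)
    · exact zero_le
  have hgne : ∀ z, g z ≠ 0 → (z.1.1 = k ∧ p.stationLink z = ν) ∧ 0 < ‖z.1.2‖ := fun z hz => by
    simp only [hgdef] at hz
    split_ifs at hz with h
    · exact ⟨h, (mem_of_indicator_ne_zero hz).2⟩
    · exact absurd rfl hz
  have main := N.hasPoissonLaplace.tsum_lintegral_mul_negExp_param N.measurable_station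
    (p.measurable_exponent k ν hs) (R := fun z : Station => ‖z.1.2‖) (by fun_prop) hg hg1
    (fun z hz => (hgne z hz).2) (fun z hz r hr hrz => by
      rw [Params.exponent, if_pos]
      · exact ENNReal.mul_ne_top ENNReal.ofReal_ne_top (p.stationGain_ne_top k ν z)
      · obtain ⟨⟨h1, h2⟩, h3⟩ := hgne z hz
        rw [Params.stationPower, h1, h2]
        exact (p.biasedPower_strictAntiOn k ν).antitoneOn hr h3 hrz)
    (p.exponent_mono k ν hsm) (p.tendsto_exponent k ν hsc)
  have hL : ∀ j n, ∫⁻ ω, g (N.station (j, n) ω) * negExp (∑' q, if q = (j, n) then 0 else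
      p.exponent k ν s ‖(N.station (j, n) ω).1.2‖ (N.station q ω)) ∂P =
      if j = k then ∫⁻ ω, {ω | N.Serves k n ω ∧ N.link k n ω = ν ∧ N.dist k n ω ∈ S}.indicator
      (fun ω => c (N.dist k n ω) * negExp (ENNReal.ofReal (s (N.dist k n ω)) *
        (N.interference k n ω / ENNReal.ofReal (p.Ptr k * p.B k * p.A ν)))) ω ∂P else 0 := by
    intro j n
    by_cases hj : j = k
    · subst hj
      rw [if_pos rfl]
      refine lintegral_congr_ae ?_
      filter_upwards [N.ae_dist_pos] with ω hω
      have hd : 0 < N.dist j n ω := hω (j, n)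
      classical
      have hgω : g (N.station (j, n) ω) =
          if N.link j n ω = ν ∧ N.dist j n ω ∈ S then c (N.dist j n ω) else 0 := by
        change (if j = j ∧ N.link j n ω = ν then
          (S ∩ Ioi 0).indicator c (N.dist j n ω) else 0) = _
        by_cases h1 : N.link j n ω = ν <;> by_cases h2 : N.dist j n ω ∈ S <;> simp [h1, h2, hd]
      rw [hgω]
      by_cases h : N.link j n ω = ν ∧ N.dist j n ω ∈ S
      · rw [if_pos h]
        refine (congrArg _ (N.negExp_tsum_exponent j ν s n ω h.1)).trans ?_
        by_cases hSv : N.Serves j n ω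
        · simp [indicator, hSv, h.1, h.2]
        · simp [indicator, hSv]
      · rw [if_neg h, zero_mul, indicator_of_notMem]
        exact fun h' => h h'.2
    · rw [if_neg hj]
      have : ∀ ω, g (N.station (j, n) ω) = 0 := fun ω => if_neg fun h => hj h.1
      simp [this]
  rw [ENNReal.tsum_prod' (f := fun i : Tier × ℕ => ∫⁻ ω, g (N.station i ω) *
    negExp (∑' q, if q = i then 0 else
      p.exponent k ν s ‖(N.station i ω).1.2‖ (N.station q ω)) ∂P)] at main
  simp only [hL] at main
  rw [tsum_eq_single k (fun j hj => by simp [hj])] at main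
  simp only [if_true] at main
  rw [main]
  have hQm : Measurable fun r => ∫⁻ ω, negExp (∑' q, p.exponent k ν s r (N.station q ω)) ∂P := by
    refine Measurable.lintegral_prod_right'
      (f := fun a : ℝ × Ω => negExp (∑' q, p.exponent k ν s a.1 (N.station q a.2))) ?_
    exact measurable_negExp.comp (Measurable.tsum fun q => (p.measurable_exponent k ν hs).comp
      (measurable_fst.prodMk ((N.measurable_station q).comp measurable_snd)))
  have hR := p.lintegral_intensity (F := fun j μ r => if j = k ∧ μ = ν then
    (S ∩ Ioi 0).indicator c r * ∫⁻ ω, negExp (∑' q, p.exponent k ν s r (N.station q ω)) ∂P else 0)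
    fun j μ => by
      split_ifs
      · exact (hc.indicator hT).mul hQm
      · exact measurable_const
  have hR' : ∀ z : Station, g z * ∫⁻ ω, negExp (∑' q, p.exponent k ν s ‖z.1.2‖ (N.station q ω)) ∂P =
      if z.1.1 = k ∧ p.stationLink z = ν then (S ∩ Ioi 0).indicator c ‖z.1.2‖ *
        ∫⁻ ω, negExp (∑' q, p.exponent k ν s ‖z.1.2‖ (N.station q ω)) ∂P else 0 := fun z => by
    simp only [hgdef]
    split_ifs
    · rfl
    · simp
  simp only [hR']
  rw [hR, Finset.sum_eq_single k, Finset.sum_eq_single ν]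
  · simp only [and_self, if_true]
    rw [← setLIntegral_indicator hS]
    refine setLIntegral_congr_fun measurableSet_Ioi fun r hr => ?_
    have hr' : (0 : ℝ) < r := hr
    by_cases hrS : r ∈ S
    · simp only [indicator_of_mem (show r ∈ S ∩ Ioi 0 from ⟨hrS, hr⟩), indicator_of_mem hrS]
      -- Radial intensity times void probabilities is the association density; the remaining factor
      -- is the Laplace transform.
      rw [N.lintegral_negExp_exponent, p.negExp_intensity_stronger k ν hr', p.assocDensity_eq,
        ENNReal.ofReal_mul (N.laplace_nonneg _ _ _ _),
        ENNReal.ofReal_mul (p.nearestRate_nonneg k ν hr'.le)]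
      ring
    · simp [hrS]
  · intro μ _ hμ; simp [hμ]
  · simp
  · intro j _ hj; simp [hj]
  · simp

end Network

/-! ### Rayleigh fading and the SINR -/

instance : NullSingletonClass (expMeasure 1) := by
  rw [expMeasure, gammaMeasure]; infer_instance

lemma expMeasure_Ioi {x : ℝ} (hx : 0 ≤ x) : expMeasure 1 (Ioi x) = ENNReal.ofReal (Real.exp (-x)) := by
  have h := cdf_expMeasure_eq one_pos x
  rw [if_pos hx, one_mul, cdf_eq_real] at h
  rw [← compl_Iic, ← ofReal_measureReal, probReal_compl_eq_one_sub measurableSet_Iic, h]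
  congr 1; ring

/-- The exponential tail at γJ/a. The degenerate cases agree with division in [0, ∞]: J = ∞ gives
ratio 0, and J = 0 gives ratio ∞ as soon as y > 0. -/
lemma expMeasure_sinr_gt {γ a : ℝ} (hγ : 0 < γ) (ha : 0 < a) (J : ℝ≥0∞) :
    expMeasure 1 {y | ENNReal.ofReal (y * a) / J ∈ Ioi (ENNReal.ofReal γ)} =
      negExp (ENNReal.ofReal (γ / a) * J) := by
  have hγa : 0 < γ / a := div_pos hγ ha
  by_cases hJ : J = ∞
  · have : ENNReal.ofReal (γ / a) ≠ 0 := by simpa using hγa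
    simp [hJ, ENNReal.mul_top this, ENNReal.div_top]
  · obtain ⟨j, hj, rfl⟩ : ∃ j : ℝ, 0 ≤ j ∧ J = ENNReal.ofReal j :=
      ⟨J.toReal, ENNReal.toReal_nonneg, (ENNReal.ofReal_toReal hJ).symm⟩
    rw [← ENNReal.ofReal_mul hγa.le, negExp_ofReal (mul_nonneg hγa.le hj),
      ← expMeasure_Ioi (mul_nonneg hγa.le hj)]
    congr 1
    ext y
    simp only [mem_ofPred_eq, mem_Ioi]
    rcases hj.eq_or_lt with rfl | hj
    · rw [mul_zero, ENNReal.ofReal_zero]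
      by_cases hy : 0 < y
      · have h1 : ENNReal.ofReal (y * a) ≠ 0 := by simpa using mul_pos hy ha
        simp [ENNReal.div_zero h1, hy]
      · have h1 : ENNReal.ofReal (y * a) = 0 :=
          ENNReal.ofReal_eq_zero.2 (mul_nonpos_of_nonpos_of_nonneg (not_lt.1 hy) ha.le)
        simp [h1, hy]
    · rw [← ENNReal.ofReal_div_of_pos hj, ENNReal.ofReal_lt_ofReal_iff_of_nonneg hγ.le,
        lt_div_iff₀ hj, div_mul_eq_mul_div, div_lt_iff₀ ha]

/-- Equality in the threshold confines y to the single point γJ/a, which is null for the exponential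
law. -/
lemma expMeasure_sinr_ge {γ a : ℝ} (hγ : 0 < γ) (ha : 0 < a) (J : ℝ≥0∞) :
    expMeasure 1 {y | ENNReal.ofReal (y * a) / J ∈ Ici (ENNReal.ofReal γ)} =
      negExp (ENNReal.ofReal (γ / a) * J) := by
  rw [← expMeasure_sinr_gt hγ ha]
  refine measure_congr ?_
  have h0 : expMeasure 1 {γ / a * J.toReal} = 0 := measure_singleton _
  filter_upwards [measure_eq_zero_iff_ae_notMem.1 h0] with y hy
  rw [mem_singleton_iff] at hy
  apply propext
  change ENNReal.ofReal γ ≤ _ ↔ ENNReal.ofReal γ < _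
  refine ⟨fun h => lt_of_le_of_ne h fun he => hy ?_, le_of_lt⟩
  have h1 : ENNReal.ofReal γ ≠ 0 := by simpa using hγ
  have hJ : J ≠ ∞ := fun hJ => h1 (by rw [he, hJ, ENNReal.div_top])
  have hJ0 : J ≠ 0 := fun hJ0 => by
    by_cases h2 : ENNReal.ofReal (y * a) = 0
    · exact h1 (by rw [he, h2, ENNReal.zero_div])
    · exact ENNReal.ofReal_ne_top (by rw [he, hJ0, ENNReal.div_zero h2])
  have h2 := congrArg ENNReal.toReal he
  rw [ENNReal.toReal_ofReal hγ.le, ENNReal.toReal_div] at h2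
  have hy0 : 0 ≤ y * a := by
    by_contra hn
    exact h1 (by rw [he, ENNReal.ofReal_eq_zero.2 (not_le.1 hn).le, ENNReal.zero_div])
  have hJp : 0 < J.toReal := ENNReal.toReal_pos hJ0 hJ
  rw [ENNReal.toReal_ofReal hy0] at h2
  rw [h2]; field_simp

namespace Network

variable {Ω : Type*} [mΩ : MeasurableSpace Ω] {P : Measure Ω} {p : Params} (N : Network P p)

lemma serves_eq (k : Tier) (n : ℕ) :
    {ω | N.Serves k n ω} = ⋂ q : Tier × ℕ, {ω | N.power q.1 q.2 ω ≤ N.power k n ω} := by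
  ext ω; simp [Serves]

section

variable {q : Tier × ℕ}

lemma measurable_link_sources (k : Tier) (n : ℕ) :
    Measurable[N.sourcesSpace {Sum.inr (Sum.inr q)}ᶜ] (N.link k n) := by
  have h : Measurable fun a : Plane × ℝ =>
      if a.2 ≤ p.losProb ‖a.1‖ then Link.los else Link.nlos :=
    Measurable.ite (measurableSet_le measurable_snd (p.measurable_losProb.comp (by fun_prop)))
      measurable_const measurable_const
  exact h.comp ((N.measurable_X_sources (by simp) n).prodMk
    (N.measurable_U_sources (q := (k, n)) (by simp)))

lemma measurable_power_sources (k : Tier) (n : ℕ) :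
    Measurable[N.sourcesSpace {Sum.inr (Sum.inr q)}ᶜ] (N.power k n) := by
  have h : Measurable fun a : Link × Plane => p.biasedPower k a.1 ‖a.2‖ :=
    measurable_from_prod_countable_right fun ν => (p.measurable_biasedPower k ν).comp measurable_norm
  exact h.comp ((N.measurable_link_sources k n).prodMk (N.measurable_X_sources (by simp) n))

/-- The interference omits the term of station q, the only one involving its fading. -/
lemma measurable_interference_sources :
    Measurable[N.sourcesSpace {Sum.inr (Sum.inr q)}ᶜ] (N.interference q.1 q.2) := by
  have hsum : Measurable fun f : Tier × ℕ → ℝ≥0∞ => ∑' q', f q' :=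
    Measurable.tsum fun q' => measurable_pi_apply q'
  have hmul : Measurable fun a : ℝ × ℝ => ENNReal.ofReal (a.1 * a.2) := by fun_prop
  refine hsum.comp (@measurable_pi_lambda _ _ _ (N.sourcesSpace {Sum.inr (Sum.inr q)}ᶜ) _ _ fun q' => ?_)
  by_cases hq : q' = q
  · simp only [hq, if_true]; exact measurable_const
  · simp only [hq, if_false]
    exact hmul.comp ((N.measurable_h_sources (by simpa using hq)).prodMk
      (N.measurable_power_sources _ _))

lemma measurableSet_serves_sources (k : Tier) (n : ℕ) :
    MeasurableSet[N.sourcesSpace {Sum.inr (Sum.inr q)}ᶜ] {ω | N.Serves k n ω} := by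
  have hle : MeasurableSet {a : ℝ × ℝ | a.1 ≤ a.2} := measurableSet_le measurable_fst measurable_snd
  rw [serves_eq]
  exact MeasurableSet.iInter fun q' =>
    ((N.measurable_power_sources (q := q) q'.1 q'.2).prodMk (N.measurable_power_sources k n)) hle

end

lemma measurableSet_serves (k : Tier) (n : ℕ) : MeasurableSet {ω | N.Serves k n ω} :=
  N.sourcesSpace_le _ _ (N.measurableSet_serves_sources (q := (k, n)) k n)

lemma measurable_interference (k : Tier) (n : ℕ) : Measurable (N.interference k n) :=
  (N.measurable_interference_sources (q := (k, n))).mono (N.sourcesSpace_le _) le_rfl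

lemma measurable_SINR (k : Tier) (n : ℕ) : Measurable (N.SINR k n) :=
  ((N.measurable_h k n).mul (N.measurable_power k n)).ennreal_ofReal.div
    ((N.measurable_interference k n).add_const _)

lemma measurableSet_serves_link (k : Tier) (ν : Link) (n : ℕ) {S : Set ℝ} (hS : MeasurableSet S) :
    MeasurableSet {ω | N.Serves k n ω ∧ N.link k n ω = ν ∧ N.dist k n ω ∈ S} :=
  (N.measurableSet_serves k n).inter
    ((N.measurable_link k n (measurableSet_singleton ν)).inter (N.measurable_dist k n hS))

lemma measurableSet_serving_SINR (k : Tier) (ν : Link) (n : ℕ) {T : Set ℝ≥0∞}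
    (hT : MeasurableSet T) :
    MeasurableSet {ω | N.Serves k n ω ∧ N.link k n ω = ν ∧ N.SINR k n ω ∈ T} :=
  (N.measurableSet_serves k n).inter
    ((N.measurable_link k n (measurableSet_singleton ν)).inter (N.measurable_SINR k n hT))

variable [IsProbabilityMeasure P]

/-- The probability of an event about the serving base station is the sum of the probabilities of
the events for each base station. -/
lemma measure_exists_serving (k : Tier) {E : ℕ → Set Ω} (hE : ∀ n, MeasurableSet (E n))
    (hsub : ∀ n ω, ω ∈ E n → N.Serves k n ω) : P {ω | ∃ n, ω ∈ E n} = ∑' n, P (E n) := by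
  rw [ofPred_exists]
  refine measure_iUnion₀ (fun m n hmn => ?_) fun n => (hE n).nullMeasurableSet
  refine measure_eq_zero_iff_ae_notMem.2 ?_
  -- The events are disjoint only almost surely, by uniqueness of the server.
  filter_upwards [N.ae_serves_unique] with ω hω h
  have := hω (k, m) (k, n) (hsub m ω h.1) (hsub n ω h.2)
  exact hmn (congrArg Prod.snd this)

/-- Powers before fading determine the server, so the event of service and the interference are
independent of the serving fading, which can be integrated out. The set T stands for either a strict
or a weak threshold. -/
lemma measure_serving_SINR (k : Tier) (ν : Link) (n : ℕ) {γ : ℝ} (hγ : 0 < γ) {T : Set ℝ≥0∞}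
    (hT : MeasurableSet T) (hTγ : ∀ a : ℝ, 0 < a → ∀ J : ℝ≥0∞,
      expMeasure 1 {y | ENNReal.ofReal (y * a) / J ∈ T} = negExp (ENNReal.ofReal (γ / a) * J)) :
    P {ω | N.Serves k n ω ∧ N.link k n ω = ν ∧ N.SINR k n ω ∈ T} =
      ∫⁻ ω, {ω | N.Serves k n ω ∧ N.link k n ω = ν ∧ N.dist k n ω ∈ univ}.indicator
        (fun ω => negExp (ENNReal.ofReal (γ * N.dist k n ω ^ p.α ν /
            (p.Ptr k * p.B k * p.A ν) * p.N₀)) *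
          negExp (ENNReal.ofReal (γ * N.dist k n ω ^ p.α ν) *
          (N.interference k n ω / ENNReal.ofReal (p.Ptr k * p.B k * p.A ν)))) ω ∂P := by
  classical
  have hmE := N.measurableSet_serving_SINR k ν n hT
  set A : Set Ω := {ω | N.Serves k n ω ∧ N.link k n ω = ν}
  have hA : MeasurableSet[N.sourcesSpace {Sum.inr (Sum.inr (k, n))}ᶜ] A :=
    (N.measurableSet_serves_sources k n).inter
      (N.measurable_link_sources k n (measurableSet_singleton ν))
  have hW : Measurable[N.sourcesSpace {Sum.inr (Sum.inr (k, n))}ᶜ] fun ω =>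
      (A.indicator (fun _ => (1 : ℝ≥0∞)) ω, N.power k n ω,
        N.interference k n ω + ENNReal.ofReal p.N₀) :=
    (measurable_const.indicator hA).prodMk ((N.measurable_power_sources k n).prodMk
      ((N.measurable_interference_sources (q := (k, n))).add_const _))
  have hSet : MeasurableSet {a : (ℝ≥0∞ × ℝ × ℝ≥0∞) × ℝ |
      ENNReal.ofReal (a.2 * a.1.2.1) / a.1.2.2 ∈ T} :=
    (by fun_prop : Measurable fun a : (ℝ≥0∞ × ℝ × ℝ≥0∞) × ℝ =>
      ENNReal.ofReal (a.2 * a.1.2.1) / a.1.2.2) hT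
  have key := N.lintegral_fading (k, n) hW
    (φ := fun a => a.1.1 * {a : (ℝ≥0∞ × ℝ × ℝ≥0∞) × ℝ |
      ENNReal.ofReal (a.2 * a.1.2.1) / a.1.2.2 ∈ T}.indicator (fun _ => 1) a)
    (measurable_fst.fst.mul (measurable_const.indicator hSet))
  rw [← lintegral_indicator_one hmE]
  refine Eq.trans (lintegral_congr fun ω => ?_) (key.trans (lintegral_congr_ae ?_))
  · change _ = A.indicator (fun _ => (1 : ℝ≥0∞)) ω *
      (if N.SINR k n ω ∈ T then (1 : ℝ≥0∞) else 0)
    by_cases h1 : N.Serves k n ω <;> by_cases h2 : N.link k n ω = ν <;>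
      by_cases h3 : N.SINR k n ω ∈ T <;> simp [A, indicator, h1, h2, h3]
  · filter_upwards [N.ae_dist_pos] with ω hω
    have hd : 0 < N.dist k n ω := hω (k, n)
    by_cases hωA : ω ∈ A
    · have hpow : N.power k n ω = p.Ptr k * p.B k * p.A ν * N.dist k n ω ^ (-p.α ν) := by
        rw [power, hωA.2, p.biasedPower_eq]
      have hpos : 0 < N.power k n ω := p.biasedPower_pos _ _ hd
      have hC := p.coef_pos k ν
      rw [indicator_of_mem (show ω ∈ {ω | N.Serves k n ω ∧ N.link k n ω = ν ∧
        N.dist k n ω ∈ univ} from ⟨hωA.1, hωA.2, trivial⟩)]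
      simp only [indicator_of_mem hωA, one_mul]
      have hm : MeasurableSet {y : ℝ | ENNReal.ofReal (y * N.power k n ω) /
          (N.interference k n ω + ENNReal.ofReal p.N₀) ∈ T} :=
        (by fun_prop : Measurable fun y : ℝ => ENNReal.ofReal (y * N.power k n ω) /
          (N.interference k n ω + ENNReal.ofReal p.N₀)) hT
      refine (lintegral_indicator_one hm).trans ?_
      rw [hTγ _ hpos, ← negExp_add]
      congr 1
      -- Dividing by the serving power, proportional to r^{-α}, produces both the Laplace parameter
      -- γ r^α and the noise exponent.
      have e : γ / N.power k n ω = γ * N.dist k n ω ^ p.α ν / (p.Ptr k * p.B k * p.A ν) := by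
        rw [hpow, Real.rpow_neg hd.le]
        have := (Real.rpow_pos_of_pos hd (p.α ν)).ne'
        field_simp
      have hq : 0 ≤ γ * N.dist k n ω ^ p.α ν := mul_nonneg hγ.le (Real.rpow_nonneg hd.le _)
      rw [e, mul_add, ← ENNReal.ofReal_mul (div_nonneg hq hC.le), add_comm]
      congr 1
      rw [ENNReal.ofReal_div_of_pos hC, div_eq_mul_inv, div_eq_mul_inv, mul_assoc, mul_comm _⁻¹]
    · have h' : ω ∉ {ω | N.Serves k n ω ∧ N.link k n ω = ν ∧ N.dist k n ω ∈ univ} :=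
        fun h => hωA ⟨h.1, h.2.1⟩
      rw [indicator_of_notMem h']
      simp [indicator_of_notMem hωA]

/-- `tsum_lintegral_serving` with s(r) = γ r^α, which is continuous and increasing for r > 0, and
the noise factor as weight c. -/
lemma tsum_measure_serving_SINR (k : Tier) (ν : Link) {γ : ℝ} (hγ : 0 < γ) {T : Set ℝ≥0∞}
    (hT : MeasurableSet T) (hTγ : ∀ a : ℝ, 0 < a → ∀ J : ℝ≥0∞,
      expMeasure 1 {y | ENNReal.ofReal (y * a) / J ∈ T} = negExp (ENNReal.ofReal (γ / a) * J)) :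
    ∑' n, P {ω | N.Serves k n ω ∧ N.link k n ω = ν ∧ N.SINR k n ω ∈ T} =
      ∫⁻ r in Ioi 0, ENNReal.ofReal (Real.exp (-γ * p.N₀ * r ^ p.α ν / (p.Ptr k * p.B k * p.A ν)) *
        N.laplace k ν r (γ * r ^ p.α ν) * p.assocDensity k ν r) := by
  simp_rw [N.measure_serving_SINR k ν _ hγ hT hTγ]
  have hα := p.α_pos ν
  have h := N.tsum_lintegral_serving k ν (s := fun r => γ * r ^ p.α ν) (by fun_prop)
    (fun a ha b _ hab => mul_le_mul_of_nonneg_left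
      (Real.rpow_le_rpow (le_of_lt ha) hab hα.le) hγ.le)
    (continuousOn_const.mul (continuousOn_id.rpow_const fun x hx => Or.inl (ne_of_gt hx)))
    (c := fun r => negExp (ENNReal.ofReal (γ * r ^ p.α ν / (p.Ptr k * p.B k * p.A ν) * p.N₀)))
    (by fun_prop) (fun r => negExp_le_one _) MeasurableSet.univ
  rw [h, univ_inter]
  refine setLIntegral_congr_fun measurableSet_Ioi fun r hr => ?_
  have hr' : (0 : ℝ) < r := hr
  have h0 : 0 ≤ γ * r ^ p.α ν / (p.Ptr k * p.B k * p.A ν) * p.N₀ :=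
    mul_nonneg (div_nonneg (mul_nonneg hγ.le (Real.rpow_nonneg hr'.le _)) (p.coef_pos k ν).le)
      p.N₀_nonneg
  change negExp _ * _ = _
  rw [negExp_ofReal h0, ← ENNReal.ofReal_mul (Real.exp_pos _).le, ← mul_assoc]
  congr 4
  ring

end Network

/-! ### Measurability of the density and the final identities -/

namespace Params

variable (p : Params)

/-- The interval integral is a difference of two integrals over the whole line of jointly measurable
indicators, so measurability in the endpoint follows from Fubini. -/
lemma measurable_voidProb (k : Tier) (ν : Link) : Measurable (p.voidProb k ν) := by
  have hl := p.measurable_linkProb ν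
  have hf : Measurable fun a : ℝ × ℝ => 2 * Real.pi * p.lam k * a.2 * p.linkProb ν a.2 := by fun_prop
  have h1 : MeasurableSet {a : ℝ × ℝ | a.2 ∈ Ioc 0 a.1} :=
    (measurableSet_lt measurable_const measurable_snd).inter
      (measurableSet_le measurable_snd measurable_fst)
  have h2 : MeasurableSet {a : ℝ × ℝ | a.2 ∈ Ioc a.1 0} :=
    (measurableSet_lt measurable_fst measurable_snd).inter
      (measurableSet_le measurable_snd measurable_const)
  have m1 := ((hf.indicator h1).stronglyMeasurable.integral_prod_right' (ν := volume)).measurable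
  have m2 := ((hf.indicator h2).stronglyMeasurable.integral_prod_right' (ν := volume)).measurable
  have : p.voidProb k ν = fun R => Real.exp (-((∫ u, {a : ℝ × ℝ | a.2 ∈ Ioc 0 a.1}.indicator
      (fun a : ℝ × ℝ => 2 * Real.pi * p.lam k * a.2 * p.linkProb ν a.2) (R, u)) -
      ∫ u, {a : ℝ × ℝ | a.2 ∈ Ioc a.1 0}.indicator
      (fun a : ℝ × ℝ => 2 * Real.pi * p.lam k * a.2 * p.linkProb ν a.2) (R, u))) := by
    funext R
    rw [voidProb, intervalIntegral, ← integral_indicator measurableSet_Ioc,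
      ← integral_indicator measurableSet_Ioc]
    rfl
  rw [this]
  exact (m1.sub m2).neg.exp

lemma measurable_assocDensity (k : Tier) (ν : Link) : Measurable (p.assocDensity k ν) := by
  have hl := p.measurable_linkProb ν
  have : p.assocDensity k ν = fun r => 2 * Real.pi * p.lam k * r * p.linkProb ν r *
      ∏ q : Tier × Link, p.voidProb q.1 q.2 (p.exclusionRadius k ν q.1 q.2 r) :=
    funext (p.assocDensity_eq k ν)
  rw [this]
  refine Measurable.mul (by fun_prop) (Finset.measurable_fun_prod _ fun q _ => ?_)
  refine (p.measurable_voidProb q.1 q.2).comp ?_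
  unfold exclusionRadius; fun_prop

end Params

namespace Network

variable {Ω : Type*} [mΩ : MeasurableSpace Ω] {P : Measure Ω} {p : Params} (N : Network P p)
  [IsProbabilityMeasure P]

lemma laplace_zero (k : Tier) (ν : Link) (r : ℝ) : N.laplace k ν r 0 = 1 := by
  simp [laplace, expNeg]

/-- The case s = 0, c = 1 of `tsum_lintegral_serving`: the interference disappears. -/
lemma measure_serving_dist (k : Tier) (ν : Link) {S : Set ℝ} (hS : MeasurableSet S) :
    P {ω | ∃ n, N.Serves k n ω ∧ N.link k n ω = ν ∧ N.dist k n ω ∈ S} =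
      ∫⁻ r in S ∩ Ioi 0, ENNReal.ofReal (p.assocDensity k ν r) := by
  have h := N.tsum_lintegral_serving k ν (s := fun _ => 0) measurable_const
    (fun _ _ _ _ _ => le_rfl) continuousOn_const (c := fun _ => 1) measurable_const
    (fun _ => le_rfl) hS
  simp only [laplace_zero, one_mul, ENNReal.ofReal_zero, zero_mul, negExp_zero] at h
  rw [← h]
  refine (N.measure_exists_serving k (fun n => N.measurableSet_serves_link k ν n hS)
    fun n ω h => h.1).trans (tsum_congr fun n => ?_)
  exact (lintegral_indicator_one (N.measurableSet_serves_link k ν n hS)).symm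

/-- The case of constant s and c = 1. Letting S vary identifies `laplace` as the conditional Laplace
transform given the serving distance. -/
lemma lintegral_serving_laplace (k : Tier) (ν : Link) (s : ℝ) {S : Set ℝ} (hS : MeasurableSet S) :
    ∫⁻ ω, ∑' n, {ω | N.Serves k n ω ∧ N.link k n ω = ν ∧ N.dist k n ω ∈ S}.indicator
          (fun ω => ENNReal.ofReal (expNeg (ENNReal.ofReal s *
            (N.interference k n ω / ENNReal.ofReal (p.Ptr k * p.B k * p.A ν))))) ω ∂P =
        ∫⁻ r in S ∩ Ioi 0, ENNReal.ofReal (N.laplace k ν r s * p.assocDensity k ν r) := by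
  have h := N.tsum_lintegral_serving k ν (s := fun _ => s) measurable_const
    (fun _ _ _ _ _ => le_rfl) continuousOn_const (c := fun _ => 1) measurable_const
    (fun _ => le_rfl) hS
  simp only [one_mul, negExp_eq_ofReal_expNeg] at h
  rw [← h]
  refine lintegral_tsum fun n => (Measurable.indicator ?_
    (N.measurableSet_serves_link k ν n hS)).aemeasurable
  exact (measurable_expNeg.comp (((N.measurable_interference k n).div_const _).const_mul
    _)).ennreal_ofReal

lemma measure_covLink (k : Tier) (ν : Link) {γ : ℝ} (hγ : 0 < γ) :
    P {ω | ∃ n, N.Serves k n ω ∧ N.link k n ω = ν ∧ ENNReal.ofReal γ ≤ N.SINR k n ω} =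
      ∫⁻ r in Ioi 0, ENNReal.ofReal (Real.exp (-γ * p.N₀ * r ^ p.α ν / (p.Ptr k * p.B k * p.A ν)) *
        N.laplace k ν r (γ * r ^ p.α ν) * p.assocDensity k ν r) := by
  rw [← N.tsum_measure_serving_SINR k ν hγ measurableSet_Ici
    fun a ha J => expMeasure_sinr_ge hγ ha J]
  exact N.measure_exists_serving k (fun n => N.measurableSet_serving_SINR k ν n measurableSet_Ici)
    fun n ω h => h.1

/-- Strict and weak thresholds give the same integral for each link condition, so the strict event
can be split over link conditions and compared with the weak ones. -/
lemma measure_cov (k : Tier) {γ : ℝ} (hγ : 0 < γ) :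
    P {ω | ∃ n, N.Serves k n ω ∧ ENNReal.ofReal γ < N.SINR k n ω} =
      ∑ ν, P {ω | ∃ n, N.Serves k n ω ∧ N.link k n ω = ν ∧ ENNReal.ofReal γ ≤ N.SINR k n ω} := by
  have hm : ∀ n, MeasurableSet {ω | N.Serves k n ω ∧ ENNReal.ofReal γ < N.SINR k n ω} := fun n =>
    (N.measurableSet_serves k n).inter (N.measurable_SINR k n measurableSet_Ioi)
  have hν : ∀ ν, P {ω | ∃ n, N.Serves k n ω ∧ N.link k n ω = ν ∧
      ENNReal.ofReal γ ≤ N.SINR k n ω} = ∑' n, P {ω | N.Serves k n ω ∧ N.link k n ω = ν ∧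
        N.SINR k n ω ∈ Ioi (ENNReal.ofReal γ)} := fun ν => by
    rw [N.measure_covLink k ν hγ, N.tsum_measure_serving_SINR k ν hγ measurableSet_Ioi
      fun a ha J => expMeasure_sinr_gt hγ ha J]
  simp_rw [hν]
  rw [← Summable.tsum_finsetSum fun ν _ => ENNReal.summable]
  refine (N.measure_exists_serving k hm fun n ω h => h.1).trans (tsum_congr fun n => ?_)
  rw [← measure_biUnion_finset]
  · congr 1
    ext ω
    simp
  · intro ν _ ν' _ hne
    exact disjoint_left.2 fun ω h h' => hne (h.2.1.symm.trans h'.2.1)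
  · exact fun ν _ => N.measurableSet_serving_SINR k ν n measurableSet_Ioi

end Network

end MmWave

/-- Coverage probability of a typical user of the two-tier network. The first two conjuncts say
that `assocDensity` is the density of the serving distance on the event of association, and that
`laplace` is the conditional Laplace transform of the actual interference given that event and the
serving distance. -/
theorem proposition2 {Ω : Type*} [MeasurableSpace Ω] (P : Measure Ω) [IsProbabilityMeasure P]
    (p : MmWave.Params) (N : MmWave.Network P p) (k : MmWave.Tier) :
    (∀ (ν : MmWave.Link) (S : Set ℝ), MeasurableSet S →
      P {ω | ∃ n, N.Serves k n ω ∧ N.link k n ω = ν ∧ N.dist k n ω ∈ S} =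
        ∫⁻ r in S ∩ Ioi 0, ENNReal.ofReal (p.assocDensity k ν r)) ∧
    (∀ (ν : MmWave.Link) (s : ℝ), 0 ≤ s → ∀ S : Set ℝ, MeasurableSet S →
      ∫⁻ ω, ∑' n, {ω | N.Serves k n ω ∧ N.link k n ω = ν ∧ N.dist k n ω ∈ S}.indicator
          (fun ω => ENNReal.ofReal (MmWave.expNeg (ENNReal.ofReal s *
            (N.interference k n ω / ENNReal.ofReal (p.Ptr k * p.B k * p.A ν))))) ω ∂P =
        ∫⁻ r in S ∩ Ioi 0, ENNReal.ofReal (N.laplace k ν r s * p.assocDensity k ν r)) ∧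
    (∀ γ : ℝ, 0 < γ →
      N.covProb k γ = N.covProbLink k MmWave.Link.los γ + N.covProbLink k MmWave.Link.nlos γ ∧
      ∀ ν : MmWave.Link,
        IntegrableOn (fun r : ℝ =>
          Real.exp (-γ * p.N₀ * r ^ p.α ν / (p.Ptr k * p.B k * p.A ν)) *
            N.laplace k ν r (γ * r ^ p.α ν) * p.assocDensity k ν r) (Ioi 0) ∧
        N.covProbLink k ν γ = ∫ r in Ioi (0 : ℝ),
          Real.exp (-γ * p.N₀ * r ^ p.α ν / (p.Ptr k * p.B k * p.A ν)) *
            N.laplace k ν r (γ * r ^ p.α ν) * p.assocDensity k ν r) := by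
  refine ⟨fun ν S hS => N.measure_serving_dist k ν hS,
    fun ν s _ S hS => N.lintegral_serving_laplace k ν s hS, fun γ hγ => ⟨?_, fun ν => ?_⟩⟩
  · simp only [MmWave.Network.covProb, MmWave.Network.covProbLink, Measure.real]
    rw [N.measure_cov k hγ, ENNReal.toReal_sum fun ν _ => measure_ne_top _ _]
    have : (Finset.univ : Finset MmWave.Link) = {MmWave.Link.los, MmWave.Link.nlos} := rfl
    rw [this, Finset.sum_pair (by simp)]
  · have hs : Measurable fun r : ℝ => γ * r ^ p.α ν := by fun_prop
    have hm : Measurable fun r : ℝ =>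
        Real.exp (-γ * p.N₀ * r ^ p.α ν / (p.Ptr k * p.B k * p.A ν)) *
          N.laplace k ν r (γ * r ^ p.α ν) * p.assocDensity k ν r :=
      Measurable.mul (Measurable.mul (by fun_prop) (N.measurable_laplace k ν hs))
        (p.measurable_assocDensity k ν)
    have h0 : ∀ᵐ r ∂volume.restrict (Ioi (0 : ℝ)),
        0 ≤ Real.exp (-γ * p.N₀ * r ^ p.α ν / (p.Ptr k * p.B k * p.A ν)) *
          N.laplace k ν r (γ * r ^ p.α ν) * p.assocDensity k ν r :=
      (ae_restrict_iff' measurableSet_Ioi).2 (Filter.Eventually.of_forall fun r hr =>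
        mul_nonneg (mul_nonneg (Real.exp_pos _).le (N.laplace_nonneg _ _ _ _))
          (p.assocDensity_nonneg k ν (le_of_lt hr)))
    have hcov := N.measure_covLink k ν hγ
    refine ⟨⟨hm.aestronglyMeasurable, ?_⟩, ?_⟩
    · rw [hasFiniteIntegral_iff_ofReal h0, ← hcov]
      exact measure_lt_top _ _
    · rw [integral_eq_lintegral_of_nonneg_ae h0 hm.aestronglyMeasurable, ← hcov]
      rfl
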